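/- All graphs are finite and simple. A graph is planar if it can be drawn in the Euclidean plane so that vertices are distinct points, edges are (polygonal) simple arcs joining their ends and containing no other vertices, and two edges meet only in common ends. It is $2$-connected if it has at least three vertices, is connected, and remains connected after deleting any one vertex. Let $d(v)$ denote the degree of a vertex $v$ in $G$, let $\Delta$ be the maximum degree of $G$, and let $n_k(v)$ (respectively $n_{k^-}(v)$) denote the number of neighbours of $v$ of degree exactly $k$ (respectively at most $k$). **Lemma 1.** Let $G$ be a $2$-connected planar graph with $\Delta\ge 5$. Then $G$ contains at least one of the following configurations. (A1) A path $uvw$ with $d(v)=2$ and $d(u)\le 9$. (A2) A vertex $u$ with $n_2(u)\ge 1$ and $n_{8^-}(u)\ge d(u)-8$ such that at least one of the following holds: (A2.1) $n_{8^-}(u)\ge d(u)-7$; (A2.2) $n_{8^-}(u)=d(u)-8$ and $n_2(u)\ge d(u)-9$. (A3) A vertex $u$ with $d(u)=3$ adjacent to a vertex $v$ such that at least one of the following holds: (A3.1) $d(v)\le 8$; (A3.2) $d(v)=9$ and there is a vertex $u_2$ with $uu_2, vu_2\in E(G)$; (A3.3) $d(v)=10$, $n_{5^-}(v)\ge 5$,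 and there are two distinct vertices $u_1,u_2$ with $uu_i, vu_i\in E(G)$ for $i=1,2$. (A4) A vertex $v$ whose neighbours can be labelled $u=v_1,v_2,\dots,v_{d(v)}$ with $d(u)\le d(v_2)\le\cdots\le d(v_{d(v)})$ such that at least one of the following holds: (A4.1) $d(v)=4$, $4\le d(u)\le 7$, and $d(u)+d(v_2)\le 17$; (A4.2) $d(v)=5$, and either $4\le d(u)\le 6$ and $d(u)+d(v_2)+d(v_3)\le 18$, or $d(u)=d(v_2)=6$, $d(v_3)=d(v_4)=d(v_5)=7$ and $uv_5\in E(G)$. -/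

import Mathlib

namespace SimpleGraph

/-- The Euclidean plane. -/
abbrev Plane : Type := EuclideanSpace ℝ (Fin 2)

/-- `S` is a (polygonal) arc joining the points `a` and `b`: the union of finitely many, and at
least one, nondegenerate straight line segments `[p 0, p 1], [p 1, p 2], …, [p (n-1), p n]` with
`p 0 = a` and `p n = b`, where consecutive segments meet only in their common end and all other
pairs of segments are disjoint. -/
def IsArc (a b : Plane) (S : Set Plane) : Prop :=
  ∃ (n : ℕ) (p : ℕ → Plane),
    0 < n ∧ p 0 = a ∧ p n = b ∧
    (∀ i, i < n → p i ≠ p (i + 1)) ∧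
    (∀ i, i + 1 < n →
      segment ℝ (p i) (p (i + 1)) ∩ segment ℝ (p (i + 1)) (p (i + 2)) = {p (i + 1)}) ∧
    (∀ i j, i + 1 < j → j < n →
      Disjoint (segment ℝ (p i) (p (i + 1))) (segment ℝ (p j) (p (j + 1)))) ∧
    S = ⋃ i ∈ Set.Iio n, segment ℝ (p i) (p (i + 1))

/-- A crossing-free drawing of `G` in the plane: distinct vertices are distinct points, an edge
`uv` is an arc joining the points `u` and `v`, an edge contains no vertices other than its ends,
and two distinct edges meet only in common ends. -/
structure PlaneDrawing {V : Type*} (G : SimpleGraph V) where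
  /-- the point that represents a vertex -/
  pos : V → Plane
  /-- the arc that represents an edge (the values at non-edges are irrelevant) -/
  arc : Sym2 V → Set Plane
  pos_injective : Function.Injective pos
  isArc : ∀ u v, G.Adj u v → IsArc (pos u) (pos v) (arc s(u, v))
  vertex_on_arc : ∀ e ∈ G.edgeSet, ∀ w, pos w ∈ arc e → w ∈ e
  arc_inter_arc : ∀ e ∈ G.edgeSet, ∀ f ∈ G.edgeSet, e ≠ f →
    ∀ x ∈ arc e ∩ arc f, ∃ w, w ∈ e ∧ w ∈ f ∧ x = pos w

/-- A graph is planar if it can be drawn in the plane without crossings. -/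
def IsPlanar {V : Type*} (G : SimpleGraph V) : Prop :=
  Nonempty (PlaneDrawing G)

/-- A graph is 2-connected if it has more than two vertices, is connected, and stays connected
when any single vertex is deleted. -/
def IsTwoConnected {V : Type*} [Fintype V] (G : SimpleGraph V) : Prop :=
  2 < Fintype.card V ∧ G.Connected ∧ ∀ v : V, (G.induce {w | w ≠ v}).Connected

section Configurations

variable {V : Type*} [Fintype V] (G : SimpleGraph V) [DecidableRel G.Adj]

/-- `n_k(v)`: the number of neighbours of `v` of degree exactly `k`. -/
def numNbrs (k : ℕ) (v : V) : ℕ :=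
  ((G.neighborFinset v).filter fun w => G.degree w = k).card

/-- `n_{k⁻}(v)`: the number of neighbours of `v` of degree at most `k`. -/
def numNbrsLE (k : ℕ) (v : V) : ℕ :=
  ((G.neighborFinset v).filter fun w => G.degree w ≤ k).card

/-- `x 0, x 1, …, x (k-1)` lists the neighbours of `v`, each exactly once, in nondecreasing order
of degree. -/
def IsSortedNbrs (v : V) {k : ℕ} (x : Fin k → V) : Prop :=
  Function.Injective x ∧ Set.range x = G.neighborSet v ∧ Monotone fun i => G.degree (x i)

/-- (A1): a path `uvw` with `d(v) = 2` and `d(u) ≤ 9`. -/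
def ConfigA1 : Prop :=
  ∃ u v w : V, G.Adj u v ∧ G.Adj v w ∧ u ≠ w ∧ G.degree v = 2 ∧ G.degree u ≤ 9

/-- (A2): a vertex `u` with `n_2(u) ≥ 1`, `n_{8⁻}(u) ≥ d(u) - 8`, and
either `n_{8⁻}(u) ≥ d(u) - 7`, or `n_{8⁻}(u) = d(u) - 8` and `n_2(u) ≥ d(u) - 9`;
the differences are differences of integers. -/
def ConfigA2 : Prop :=
  ∃ u : V, 1 ≤ G.numNbrs 2 u ∧ (G.degree u : ℤ) - 8 ≤ G.numNbrsLE 8 u ∧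
    ((G.degree u : ℤ) - 7 ≤ G.numNbrsLE 8 u ∨
      ((G.numNbrsLE 8 u : ℤ) = (G.degree u : ℤ) - 8 ∧
        (G.degree u : ℤ) - 9 ≤ G.numNbrs 2 u))

/-- (A3): a 3-vertex `u` adjacent to a vertex `v` such that `d(v) ≤ 8`, or `d(v) = 9` and `u`, `v`
have a common neighbour, or `d(v) = 10`, `n_{5⁻}(v) ≥ 5` and `u`, `v` have two common
neighbours. -/
def ConfigA3 : Prop :=
  ∃ u v : V, G.degree u = 3 ∧ G.Adj u v ∧
    (G.degree v ≤ 8 ∨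
      (G.degree v = 9 ∧ ∃ u₂, G.Adj u u₂ ∧ G.Adj v u₂) ∨
      (G.degree v = 10 ∧ 5 ≤ G.numNbrsLE 5 v ∧
        ∃ u₁ u₂, u₁ ≠ u₂ ∧ (G.Adj u u₁ ∧ G.Adj v u₁) ∧ (G.Adj u u₂ ∧ G.Adj v u₂)))

/-- (A4.1): a 4-vertex `v` with neighbours `u = x 0`, `x 1`, `x 2`, `x 3` in nondecreasing order of
degree such that `4 ≤ d(u) ≤ 7` and the two smallest degrees sum to at most 17. -/
def ConfigA41 : Prop :=
  ∃ (v : V) (x : Fin 4 → V), G.degree v = 4 ∧ G.IsSortedNbrs v x ∧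
    4 ≤ G.degree (x 0) ∧ G.degree (x 0) ≤ 7 ∧ G.degree (x 0) + G.degree (x 1) ≤ 17

/-- (A4.2): a 5-vertex `v` with neighbours `u = x 0`, `x 1`, …, `x 4` in nondecreasing order of
degree such that `4 ≤ d(u) ≤ 6` and the three smallest degrees sum to at most 18, or the degrees
are `6, 6, 7, 7, 7` and `u = x 0` is adjacent to `x 4`. -/
def ConfigA42 : Prop :=
  ∃ (v : V) (x : Fin 5 → V), G.degree v = 5 ∧ G.IsSortedNbrs v x ∧
    ((4 ≤ G.degree (x 0) ∧ G.degree (x 0) ≤ 6 ∧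
        G.degree (x 0) + G.degree (x 1) + G.degree (x 2) ≤ 18) ∨
      (G.degree (x 0) = 6 ∧ G.degree (x 1) = 6 ∧
        G.degree (x 2) = 7 ∧ G.degree (x 3) = 7 ∧ G.degree (x 4) = 7 ∧ G.Adj (x 0) (x 4)))

/-- (A4): (A4.1) or (A4.2). -/
def ConfigA4 : Prop :=
  G.ConfigA41 ∨ G.ConfigA42

end Configurations

end SimpleGraph

/-
Fix a polygonal drawing and a cycle modulo 2, and give each point the parity of the number of
segments of the cycle above it. Sweeping a vertical line over the drawing shows that this parity is
constant along the boundary walk of a face and changes across exactly the edges of the cycle, so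
every element of the cycle space is the boundary of a set of faces. Comparing dimensions over
`ZMod 2` gives Euler's formula as the inequality `e + 1 ≤ v + f`, without the Jordan curve theorem.

If no configuration occurs, pass to the subgraph induced by the vertices of degree at least 3, and
charge each vertex with its degree minus 6 and each face with twice its length minus 6. When the
nontriangular faces and the vertices of degree at least 7 pay for the vertices of degree 3, 4 and 5,
no charge ends up negative, although Euler's inequality makes the total negative.
-/

open SimpleGraph

/-- A finite family of straight segments in a real plane `E` with linear coordinates `X` and `Y`,
no two of which meet except in common ends, as the union of edges of a drawing is after cutting it
at its bends. `D` indexes the *directed* segments: `d` runs from `base d` to `base (rev d)`, and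
`rev d` is the same segment traversed backwards. No two distinct ends have the same abscissa, so
that a vertical line sweeps over the ends one at a time. -/
structure SegmentFamily (D E : Type*) [AddCommGroup E] [Module ℝ E] where
  X : E →ₗ[ℝ] ℝ
  Y : E →ₗ[ℝ] ℝ
  coord_ext : ∀ p q, X p = X q → Y p = Y q → p = q
  base : D → E
  rev : D → D
  rev_rev : ∀ d, rev (rev d) = d
  base_rev_ne : ∀ d, base (rev d) ≠ base d
  base_eq_of_X_eq : ∀ d e, X (base d) = X (base e) → base d = base e
  eq_end : ∀ d e, e ≠ d → e ≠ rev d → ∀ z ∈ segment ℝ (base d) (base (rev d)),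
    z ∈ segment ℝ (base e) (base (rev e)) → z = base d ∨ z = base (rev d)

namespace SegmentFamily

variable {D E : Type*} [AddCommGroup E] [Module ℝ E] (F : SegmentFamily D E)

/-- The abscissa of the starting point of a directed segment. -/
def x (d : D) : ℝ := F.X (F.base d)

/-- The ordinate of the starting point of a directed segment. -/
def y (d : D) : ℝ := F.Y (F.base d)

/-- A directed segment is rightward if it runs in the direction of increasing abscissas. -/
def Rightward (d : D) : Prop := F.x d < F.x (F.rev d)

/-- The slope of the line through a segment. -/
noncomputable def slope (d : D) : ℝ := (F.y (F.rev d) - F.y d) / (F.x (F.rev d) - F.x d)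

/-- The ordinate of the point with abscissa `a` on the line through a segment. -/
noncomputable def height (d : D) (a : ℝ) : ℝ := F.y d + F.slope d * (a - F.x d)

/-- The mirror image in a vertical line; it turns statements about left ends of segments into
statements about right ends. -/
def mirror : SegmentFamily D E :=
  { F with
    X := -F.X
    coord_ext := fun p q hX hY => F.coord_ext p q (neg_injective hX) hY
    base_eq_of_X_eq := fun d e h => F.base_eq_of_X_eq d e (neg_injective h) }

theorem x_ne_x_rev (d : D) : F.x d ≠ F.x (F.rev d) := fun h =>
  F.base_rev_ne d (F.base_eq_of_X_eq _ _ h.symm)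

theorem base_eq_iff {d e : D} : F.base e = F.base d ↔ F.x e = F.x d :=
  ⟨congrArg F.X, F.base_eq_of_X_eq e d⟩

theorem rightward_rev_iff (d : D) : F.Rightward (F.rev d) ↔ ¬ F.Rightward d := by
  rw [Rightward, Rightward, F.rev_rev, not_lt, le_iff_lt_or_eq,
    or_iff_left (F.x_ne_x_rev d).symm]

theorem slope_rev (d : D) : F.slope (F.rev d) = F.slope d := by
  rw [slope, slope, F.rev_rev, ← neg_sub (F.y _), ← neg_sub (F.x _), neg_div_neg_eq]

theorem height_self (d : D) : F.height d (F.x d) = F.y d := by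
  simp [height]

theorem height_rev (d : D) (a : ℝ) : F.height (F.rev d) a = F.height d a := by
  have h : F.x (F.rev d) - F.x d ≠ 0 := sub_ne_zero.2 (F.x_ne_x_rev d).symm
  have hs : F.slope d * (F.x (F.rev d) - F.x d) = F.y (F.rev d) - F.y d := div_mul_cancel₀ _ h
  rw [height, height, slope_rev]
  linear_combination -hs

theorem continuous_height (d : D) : Continuous (F.height d) := by
  unfold height
  fun_prop

section Mirror

theorem mirror_x (d : D) : F.mirror.x d = -F.x d := rfl

theorem mirror_rightward (d : D) : F.mirror.Rightward d ↔ F.Rightward (F.rev d) := by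
  rw [Rightward, Rightward, F.rev_rev]
  exact neg_lt_neg_iff

theorem mirror_slope (d : D) : F.mirror.slope d = -F.slope d := by
  change (F.y (F.rev d) - F.y d) / (-F.x (F.rev d) - -F.x d) = -F.slope d
  rw [slope, ← div_neg]
  ring_nf

theorem mirror_height (d : D) (a : ℝ) : F.mirror.height d (-a) = F.height d a := by
  rw [height, height, mirror_slope, mirror_x]
  change F.y d + _ = _
  ring

end Mirror

/-- `e` runs above `d`: over some abscissa interior to both segments, and hence over all those. -/
def Over (d e : D) : Prop :=
  ∃ a, a ∈ Set.Ioo (F.x d) (F.x (F.rev d)) ∧ a ∈ Set.Ioo (F.x e) (F.x (F.rev e)) ∧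
    F.height d a < F.height e a

/-- The segment passes strictly above the point `q`. -/
def PassesAbove (d : D) (q : E) : Prop :=
  F.X q ∈ Set.Ioo (F.x d) (F.x (F.rev d)) ∧ F.Y q < F.height d (F.X q)

/-- The segment passes strictly below the point `q`. -/
def PassesBelow (d : D) (q : E) : Prop :=
  F.X q ∈ Set.Ioo (F.x d) (F.x (F.rev d)) ∧ F.height d (F.X q) < F.Y q

section Comparison

variable {F} {d e : D} {a b : ℝ}

theorem Over.rightward_right (h : F.Over d e) : F.Rightward e :=
  let ⟨_, _, hae, _⟩ := h
  hae.1.trans hae.2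

theorem mirror_over : F.mirror.Over d e ↔ F.Over (F.rev d) (F.rev e) := by
  refine (Equiv.neg ℝ).exists_congr_left.trans (exists_congr fun a => ?_)
  change -a ∈ Set.Ioo (-F.x d) (-F.x (F.rev d)) ∧ -a ∈ Set.Ioo (-F.x e) (-F.x (F.rev e)) ∧
    F.mirror.height d (-a) < F.mirror.height e (-a) ↔ _
  simp only [Set.neg_mem_Ioo_iff, neg_neg, mirror_height, F.rev_rev, height_rev]

theorem mirror_passesAbove {q : E} : F.mirror.PassesAbove d q ↔ F.PassesAbove (F.rev d) q := by
  change -F.X q ∈ Set.Ioo (-F.x d) (-F.x (F.rev d)) ∧ F.Y q < F.mirror.height d (-F.X q) ↔ _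
  simp only [PassesAbove, Set.neg_mem_Ioo_iff, neg_neg, mirror_height, F.rev_rev, height_rev]

theorem mirror_passesBelow {q : E} : F.mirror.PassesBelow d q ↔ F.PassesBelow (F.rev d) q := by
  change -F.X q ∈ Set.Ioo (-F.x d) (-F.x (F.rev d)) ∧ F.mirror.height d (-F.X q) < F.Y q ↔ _
  simp only [PassesBelow, Set.neg_mem_Ioo_iff, neg_neg, mirror_height, F.rev_rev, height_rev]

theorem exists_mem_segment (hd : F.Rightward d) (ha : a ∈ Set.Icc (F.x d) (F.x (F.rev d))) :
    ∃ z ∈ segment ℝ (F.base d) (F.base (F.rev d)), F.X z = a ∧ F.Y z = F.height d a := by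
  have hpos : 0 < F.x (F.rev d) - F.x d := sub_pos.2 hd
  set θ := (a - F.x d) / (F.x (F.rev d) - F.x d) with hθ
  have hθa : θ * (F.x (F.rev d) - F.x d) = a - F.x d := div_mul_cancel₀ _ hpos.ne'
  refine ⟨AffineMap.lineMap (F.base d) (F.base (F.rev d)) θ, ?_, ?_, ?_⟩
  · rw [segment_eq_image_lineMap]
    exact ⟨θ, ⟨div_nonneg (sub_nonneg.2 ha.1) hpos.le,
      (div_le_one hpos).2 (sub_le_sub_right ha.2 _)⟩, rfl⟩
  · simp only [AffineMap.lineMap_apply, vsub_eq_sub, vadd_eq_add, map_add, map_smul, map_sub,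
      smul_eq_mul]
    exact eq_sub_iff_add_eq.1 hθa
  · simp only [AffineMap.lineMap_apply, vsub_eq_sub, vadd_eq_add, map_add, map_smul, map_sub,
      smul_eq_mul, height, slope]
    rw [hθ, x, x, y, y]
    ring

theorem height_ne (hde : e ≠ d) (he : F.Rightward e)
    (had : a ∈ Set.Ioo (F.x d) (F.x (F.rev d))) (hae : a ∈ Set.Icc (F.x e) (F.x (F.rev e))) :
    F.height d a ≠ F.height e a := by
  intro h
  have hd : F.Rightward d := had.1.trans had.2
  obtain ⟨z, hz, hzX, hzY⟩ := exists_mem_segment hd (Set.Ioo_subset_Icc_self had)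
  obtain ⟨w, hw, hwX, hwY⟩ := exists_mem_segment he hae
  obtain rfl : z = w := F.coord_ext z w (hzX.trans hwX.symm) (hzY.trans (h.trans hwY.symm))
  have hrev : e ≠ F.rev d := by
    rintro rfl
    exact (F.rightward_rev_iff d).1 he hd
  rcases F.eq_end d e hde hrev z hz hw with rfl | rfl
  · exact had.1.ne hzX
  · exact had.2.ne hzX.symm

/-- By the intermediate value theorem, since the segments do not cross. -/
theorem height_lt_of_height_lt (hde : e ≠ d) (had : a ∈ Set.Icc (F.x d) (F.x (F.rev d)))
    (hae : a ∈ Set.Icc (F.x e) (F.x (F.rev e))) (hbd : b ∈ Set.Ioo (F.x d) (F.x (F.rev d)))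
    (hbe : b ∈ Set.Ioo (F.x e) (F.x (F.rev e))) (hlt : F.height d b < F.height e b)
    (hne : F.height d a ≠ F.height e a) : F.height d a < F.height e a := by
  by_contra! hle
  have hcont : ContinuousOn (fun u => F.height e u - F.height d u) (Set.uIcc a b) :=
    ((F.continuous_height e).sub (F.continuous_height d)).continuousOn
  obtain ⟨z, hz, hz0⟩ := intermediate_value_uIcc hcont
    (Set.mem_uIcc_of_le (sub_nonpos.2 hle) (sub_nonneg.2 hlt.le))
  have hza : z ≠ a := by
    rintro rfl
    exact hne (sub_eq_zero.1 hz0).symm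
  have hzd : z ∈ Set.Ioo (F.x d) (F.x (F.rev d)) := by
    rcases Set.mem_uIcc.1 hz with h | h
    · exact ⟨had.1.trans_lt (h.1.lt_of_ne hza.symm), h.2.trans_lt hbd.2⟩
    · exact ⟨hbd.1.trans_le h.1, (h.2.lt_of_ne hza).trans_le had.2⟩
  have hze : z ∈ Set.Icc (F.x e) (F.x (F.rev e)) :=
    Set.uIcc_subset_Icc hae (Set.Ioo_subset_Icc_self hbe) hz
  exact height_ne hde (hbe.1.trans hbe.2) hzd hze (sub_eq_zero.1 hz0).symm

theorem over_iff_height_lt (hde : e ≠ d) (had : a ∈ Set.Icc (F.x d) (F.x (F.rev d)))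
    (hae : a ∈ Set.Icc (F.x e) (F.x (F.rev e)))
    (hlt : max (F.x d) (F.x e) < min (F.x (F.rev d)) (F.x (F.rev e)))
    (hne : F.height d a ≠ F.height e a) : F.Over d e ↔ F.height d a < F.height e a := by
  refine ⟨fun ⟨b, hbd, hbe, h⟩ => height_lt_of_height_lt hde had hae hbd hbe h hne, fun h => ?_⟩
  obtain ⟨b, hb₁, hb₂⟩ := exists_between hlt
  have hbd : b ∈ Set.Ioo (F.x d) (F.x (F.rev d)) :=
    ⟨(le_max_left _ _).trans_lt hb₁, hb₂.trans_le (min_le_left _ _)⟩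
  have hbe : b ∈ Set.Ioo (F.x e) (F.x (F.rev e)) :=
    ⟨(le_max_right _ _).trans_lt hb₁, hb₂.trans_le (min_le_right _ _)⟩
  have hbne := height_ne hde (hbe.1.trans hbe.2) hbd (Set.Ioo_subset_Icc_self hbe)
  refine ⟨b, hbd, hbe, hbne.lt_of_le (not_lt.1 fun hb => ?_)⟩
  exact h.not_gt (height_lt_of_height_lt hde.symm hae had hbe hbd hb hne.symm)

theorem over_iff_passesAbove (hd : F.Rightward d) (h : F.x e < F.x d) :
    F.Over d e ↔ F.PassesAbove e (F.base d) := by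
  have hde : e ≠ d := by
    rintro rfl
    exact h.false
  change _ ↔ F.x d ∈ Set.Ioo (F.x e) (F.x (F.rev e)) ∧ F.y d < F.height e (F.x d)
  by_cases hlt : F.x d < F.x (F.rev e)
  · have hmem : F.x d ∈ Set.Ioo (F.x e) (F.x (F.rev e)) := ⟨h, hlt⟩
    rw [and_iff_right hmem, ← F.height_self d]
    refine over_iff_height_lt hde (Set.left_mem_Icc.2 hd.le) (Set.Ioo_subset_Icc_self hmem) ?_
      (height_ne hde.symm hd hmem (Set.left_mem_Icc.2 hd.le)).symm
    exact max_lt (lt_min hd hlt) (lt_min (h.trans hd) (h.trans hlt))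
  · refine iff_of_false (fun ⟨a, had, hae, _⟩ => hlt (had.1.trans hae.2)) fun h' => hlt h'.1.2

theorem over_iff_passesBelow (he : F.Rightward e) (h : F.x d < F.x e) :
    F.Over d e ↔ F.PassesBelow d (F.base e) := by
  have hde : e ≠ d := by
    rintro rfl
    exact h.false
  change _ ↔ F.x e ∈ Set.Ioo (F.x d) (F.x (F.rev d)) ∧ F.height d (F.x e) < F.y e
  by_cases hlt : F.x e < F.x (F.rev d)
  · have hmem : F.x e ∈ Set.Ioo (F.x d) (F.x (F.rev d)) := ⟨h, hlt⟩
    rw [and_iff_right hmem, ← F.height_self e]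
    refine over_iff_height_lt hde (Set.Ioo_subset_Icc_self hmem) (Set.left_mem_Icc.2 he.le) ?_
      (height_ne hde he hmem (Set.left_mem_Icc.2 he.le))
    exact max_lt (lt_min (h.trans hlt) (h.trans he)) (lt_min hlt he)
  · refine iff_of_false (fun ⟨a, had, hae, _⟩ => hlt (hae.1.trans had.2)) fun h' => hlt h'.1.2

theorem over_iff_slope_lt (hd : F.Rightward d) (he : F.Rightward e) (h : F.base e = F.base d) :
    F.Over d e ↔ F.slope d < F.slope e := by
  have hx : F.x e = F.x d := congrArg F.X h
  have hy : F.y e = F.y d := congrArg F.Y h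
  have hiff {a : ℝ} (ha : F.x d < a) :
      F.height d a < F.height e a ↔ F.slope d < F.slope e := by
    rw [height, height, hx, hy, add_lt_add_iff_left, mul_lt_mul_iff_left₀ (sub_pos.2 ha)]
  refine ⟨fun ⟨a, had, _, ha⟩ => (hiff had.1).1 ha, fun hs => ?_⟩
  obtain ⟨a, ha, hlt⟩ := exists_between (lt_min hd (hx ▸ he : F.x d < F.x (F.rev e)))
  exact ⟨a, ⟨ha, hlt.trans_le (min_le_left _ _)⟩,
    ⟨hx ▸ ha, hlt.trans_le (min_le_right _ _)⟩, (hiff ha).2 hs⟩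

open Classical in
theorem ite_over {A : Type*} [AddMonoid A] (hd : F.Rightward d) (t : D) (a : A) :
    (if F.PassesAbove t (F.base d) then a else 0) +
        (if F.base t = F.base d ∧ F.Rightward t ∧ F.slope d < F.slope t then a else 0) +
      (if F.Rightward t ∧ F.PassesBelow d (F.base t) then a else 0) =
    if F.Over d t then a else 0 := by
  by_cases ht : F.Rightward t
  swap
  · have h₁ : ¬ F.PassesAbove t (F.base d) := fun h => ht (h.1.1.trans h.1.2)
    have h₂ : ¬ F.Over d t := fun h => ht h.rightward_right
    simp only [ht, h₁, h₂, false_and, and_false, if_false, add_zero]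
  rcases lt_trichotomy (F.x t) (F.x d) with h | h | h
  · have hb : F.base t ≠ F.base d := fun hb => h.ne (F.base_eq_iff.1 hb)
    have hM : ¬ F.PassesBelow d (F.base t) := fun hM => hM.1.1.not_gt h
    simp only [hb, hM, false_and, and_false, if_false, add_zero, over_iff_passesAbove hd h]
  · have hA : ¬ F.PassesAbove t (F.base d) := fun hA => hA.1.1.ne h
    have hM : ¬ F.PassesBelow d (F.base t) := fun hM => hM.1.1.ne' h
    have hb : F.base t = F.base d := F.base_eq_iff.2 h
    simp only [hb, hA, hb ▸ hM, ht, true_and, and_false, if_false, add_zero, zero_add,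
      over_iff_slope_lt hd ht hb]
  · have hb : F.base t ≠ F.base d := fun hb => h.ne' (F.base_eq_iff.1 hb)
    have hA : ¬ F.PassesAbove t (F.base d) := fun hA => hA.1.1.not_gt h
    simp only [hb, hA, ht, false_and, true_and, if_false, zero_add, over_iff_passesBelow ht h]

end Comparison

theorem eq_of_slope_eq {d e : D} (hd : F.Rightward d) (he : F.Rightward e)
    (hb : F.base d = F.base e) (hs : F.slope d = F.slope e) : d = e := by
  by_contra hde
  have hx : F.x d = F.x e := congrArg F.X hb
  have hy : F.y d = F.y e := congrArg F.Y hb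
  obtain ⟨a, ha, hlt⟩ := exists_between (lt_min hd (hx ▸ he : F.x d < F.x (F.rev e)))
  have hae : a ∈ Set.Icc (F.x e) (F.x (F.rev e)) :=
    ⟨hx ▸ ha.le, hlt.le.trans (min_le_right _ _)⟩
  exact height_ne (Ne.symm hde) he ⟨ha, hlt.trans_le (min_le_left _ _)⟩ hae
    (by rw [height, height, hx, hy, hs])

/-- Directed segments with the same starting point are in counterclockwise order, from straight
down, when they are ordered by this key. -/
noncomputable def key (d : D) : Bool ×ₗ ℝ :=
  toLex (decide (F.x (F.rev d) < F.x d), F.slope d)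

theorem key_of_rightward {d : D} (hd : F.Rightward d) : F.key d = toLex (false, F.slope d) := by
  rw [key, decide_eq_false (lt_asymm hd)]

theorem key_of_not_rightward {d : D} (hd : ¬ F.Rightward d) :
    F.key d = toLex (true, F.slope d) := by
  rw [key, decide_eq_true ((F.x_ne_x_rev d).symm.lt_of_le (not_lt.1 hd))]

theorem eq_of_key_eq {d e : D} (hb : F.base d = F.base e) (hk : F.key d = F.key e) : d = e := by
  by_cases hd : F.Rightward d <;> by_cases he : F.Rightward e
  · rw [F.key_of_rightward hd, F.key_of_rightward he] at hk
    exact F.eq_of_slope_eq hd he hb (Prod.ext_iff.1 (toLex_inj.1 hk)).2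
  · simp [F.key_of_rightward hd, F.key_of_not_rightward he] at hk
  · simp [F.key_of_not_rightward hd, F.key_of_rightward he] at hk
  · rw [F.key_of_not_rightward hd, F.key_of_not_rightward he] at hk
    refine F.mirror.eq_of_slope_eq ?_ ?_ hb ?_
    · rwa [mirror_rightward, rightward_rev_iff]
    · rwa [mirror_rightward, rightward_rev_iff]
    · rw [mirror_slope, mirror_slope]
      exact congrArg Neg.neg (Prod.ext_iff.1 (toLex_inj.1 hk)).2

section Parity

variable [Fintype D] {c : D → ZMod 2} {d e : D}

open Classical in
variable (c) in
/-- A cycle modulo 2: a set of segments, given by its characteristic function, such that every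
point is an end of an even number of them. -/
structure IsCycle : Prop where
  rev : ∀ d, c (F.rev d) = c d
  sum_base : ∀ q, ∑ d with F.base d = q, c d = 0

open Classical in
variable (c) in
/-- The number, mod 2, of segments of `c` strictly above a point. Inside a region of the complement
of a cycle it is constant, and it changes across the segments of the cycle. -/
noncomputable def aboveParity (q : E) : ZMod 2 := ∑ t with F.PassesAbove t q, c t

open Classical in
variable (c) in
/-- The parity of the region just above the start of a rightward segment. -/
noncomputable def overParity (d : D) : ZMod 2 :=
  F.aboveParity c (F.base d) +
    ∑ t with F.base t = F.base d ∧ F.Rightward t ∧ F.slope d < F.slope t, c t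

open Classical in
variable (c) in
/-- The parity of the region just below a point. -/
noncomputable def belowParity (q : E) : ZMod 2 :=
  F.aboveParity c q + ∑ t with F.base t = q ∧ F.Rightward t, c t

open Classical in
variable (c) in
/-- The parity of the region on the left of a directed segment, near its start: that of the region
below the starting point, corrected by the segments met on the way counterclockwise. -/
noncomputable def leftParity (d : D) : ZMod 2 :=
  F.belowParity c (F.base d) + ∑ t with F.base t = F.base d ∧ F.key t ≤ F.key d, c t

variable {F}

open Classical in
theorem IsCycle.sum_base_filter (hc : F.IsCycle c) (p : E → Prop) :
    ∑ t with p (F.base t), c t = 0 := by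
  rw [← Finset.sum_fiberwise_of_maps_to fun t => Finset.mem_image_of_mem F.base]
  refine Finset.sum_eq_zero fun q hq => ?_
  obtain ⟨t, ht, rfl⟩ := Finset.mem_image.1 hq
  rw [← hc.sum_base (F.base t), Finset.filter_filter]
  refine Finset.sum_congr (Finset.filter_congr fun u _ => and_iff_right_of_imp fun hu => ?_)
    fun _ _ => rfl
  exact hu ▸ (Finset.mem_filter.1 ht).2

open Classical in
theorem IsCycle.sum_filter_rev (hc : F.IsCycle c) (p : D → Prop) :
    ∑ t with p (F.rev t), c t = ∑ t with p t, c t := by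
  refine Finset.sum_nbij' F.rev F.rev ?_ ?_ ?_ ?_ ?_ <;> simp [F.rev_rev, hc.rev]

open Classical in
variable (c) in
theorem overParity_add_sum_passesBelow (hd : F.Rightward d) :
    F.overParity c d + ∑ t with F.Rightward t ∧ F.PassesBelow d (F.base t), c t =
      ∑ t with F.Over d t, c t := by
  simp only [overParity, aboveParity, Finset.sum_filter, ← Finset.sum_add_distrib]
  exact Finset.sum_congr rfl fun t _ => ite_over hd t (c t)

open Classical in
/-- Sweeping from one end of `d` to the other, the parity above `d` only changes at ends of
segments above `d`, where it changes by an even number. -/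
theorem IsCycle.mirror_overParity_rev (hc : F.IsCycle c) (hd : F.Rightward d) :
    F.mirror.overParity c (F.rev d) = F.overParity c d := by
  have hright := overParity_add_sum_passesBelow c hd
  have hleft : F.mirror.overParity c (F.rev d) +
      ∑ t with ¬ F.Rightward t ∧ F.PassesBelow d (F.base t), c t = ∑ t with F.Over d t, c t := by
    have hd' : F.mirror.Rightward (F.rev d) := by rwa [mirror_rightward, F.rev_rev]
    rw [← hc.sum_filter_rev (F.Over d)]
    refine Eq.trans ?_ ((overParity_add_sum_passesBelow c hd').trans ?_)
    · congr 2
      ext t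
      simp only [Finset.mem_filter, mirror_rightward, rightward_rev_iff, mirror_passesBelow,
        F.rev_rev]
      rfl
    · simp only [mirror_over, F.rev_rev]
  have heven : ∑ t with F.Rightward t ∧ F.PassesBelow d (F.base t), c t =
      ∑ t with ¬ F.Rightward t ∧ F.PassesBelow d (F.base t), c t := by
    rw [← CharTwo.add_eq_zero, ← hc.sum_base_filter (F.PassesBelow d)]
    simp only [and_comm (b := F.PassesBelow d _), ← Finset.filter_filter]
    exact Finset.sum_filter_add_sum_filter_not _ _ _
  rw [← hright, heven] at hleft
  exact add_right_cancel hleft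

theorem leftParity_of_rightward (hd : F.Rightward d) : F.leftParity c d = F.overParity c d := by
  classical
  unfold leftParity belowParity overParity
  rw [add_assoc, Finset.sum_filter, Finset.sum_filter, Finset.sum_filter, ← Finset.sum_add_distrib]
  congr 1
  refine Finset.sum_congr rfl fun t _ => ?_
  by_cases ht : F.Rightward t
  · rcases lt_or_ge (F.slope d) (F.slope t) with h | h
    · simp [ht, F.key_of_rightward hd, F.key_of_rightward ht, Prod.Lex.toLex_le_toLex, h, h.not_ge]
    · simp [ht, F.key_of_rightward hd, F.key_of_rightward ht, Prod.Lex.toLex_le_toLex, h,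
        h.not_gt, CharTwo.add_self_eq_zero]
  · simp [ht, F.key_of_rightward hd, F.key_of_not_rightward ht, Prod.Lex.toLex_le_toLex]

theorem IsCycle.mirror_aboveParity (hc : F.IsCycle c) (q : E) :
    F.mirror.aboveParity c q = F.aboveParity c q := by
  classical
  simp only [aboveParity, mirror_passesAbove]
  exact hc.sum_filter_rev fun t => F.PassesAbove t q

theorem IsCycle.leftParity_of_not_rightward (hc : F.IsCycle c) (hd : ¬ F.Rightward d) :
    F.leftParity c d = F.mirror.overParity c d + c d := by
  classical
  have hsum : c d = ∑ t, if t = d then c t else 0 := by simp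
  rw [leftParity, belowParity, overParity, hc.mirror_aboveParity, hsum, add_assoc, add_assoc]
  change F.aboveParity c (F.base d) + _ = F.aboveParity c (F.base d) + _
  rw [Finset.sum_filter, Finset.sum_filter, Finset.sum_filter, ← Finset.sum_add_distrib,
    ← Finset.sum_add_distrib]
  refine congrArg _ (Finset.sum_congr rfl fun t _ => ?_)
  simp only [mirror_rightward, rightward_rev_iff, mirror_slope, neg_lt_neg_iff]
  change _ = (if F.base t = F.base d ∧ ¬ F.Rightward t ∧ F.slope t < F.slope d then c t else 0) + _
  by_cases ht : F.Rightward t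
  · have htd : t ≠ d := ne_of_apply_ne F.Rightward fun h => hd (h ▸ ht)
    simp [ht, htd, F.key_of_not_rightward hd, F.key_of_rightward ht, Prod.Lex.toLex_le_toLex,
      CharTwo.add_self_eq_zero]
  · have hkey : F.key t ≤ F.key d ↔ F.slope t ≤ F.slope d := by
      simp [F.key_of_not_rightward hd, F.key_of_not_rightward ht, Prod.Lex.toLex_le_toLex]
    have hslope (hb : F.base t = F.base d) : F.slope t = F.slope d ↔ t = d :=
      ⟨fun h => F.eq_of_key_eq hb <| by
        rw [F.key_of_not_rightward hd, F.key_of_not_rightward ht, h], congrArg F.slope⟩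
    by_cases hb : F.base t = F.base d
    · rcases lt_trichotomy (F.slope t) (F.slope d) with h | h | h
      · simp [ht, hb, hkey, h, h.le, ← hslope hb, h.ne]
      · simp [ht, hb, hkey, h, ← hslope hb]
      · simp [ht, hb, hkey, h.not_ge, h.not_gt, ← hslope hb, h.ne']
    · have htd : t ≠ d := fun h => hb (congrArg F.base h)
      simp [ht, hb, htd]

theorem IsCycle.leftParity_add_rev (hc : F.IsCycle c) (d : D) :
    F.leftParity c d + F.leftParity c (F.rev d) = c d := by
  wlog hd : F.Rightward d generalizing d
  · rw [← hc.rev d, ← this _ ((F.rightward_rev_iff d).2 hd), F.rev_rev, add_comm]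
  have hd' : ¬ F.Rightward (F.rev d) := fun h => (F.rightward_rev_iff d).1 h hd
  rw [leftParity_of_rightward hd, hc.leftParity_of_not_rightward hd', hc.mirror_overParity_rev hd,
    hc.rev, ← add_assoc, CharTwo.add_self_eq_zero, zero_add]

/-- At a point with exactly two directed segments the parity switches from one to the other as
across a segment. -/
theorem leftParity_add_of_pair (hde : d ≠ e) (hb : F.base d = F.base e)
    (hpair : ∀ t, F.base t = F.base d → t = d ∨ t = e) (hc : c d = c e) :
    F.leftParity c d + F.leftParity c e = c d := by
  classical
  wlog hlt : F.key d < F.key e generalizing d e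
  · have hk : F.key d ≠ F.key e := fun h => hde (F.eq_of_key_eq hb h)
    rw [add_comm, hc]
    exact this hde.symm hb.symm (fun t ht => (hpair t (ht.trans hb.symm)).symm) hc.symm
      (hk.symm.lt_of_le (not_lt.1 hlt))
  have hd : ∑ t with F.base t = F.base d ∧ F.key t ≤ F.key d, c t = c d := by
    rw [← Finset.sum_singleton c d]
    congr 1
    grind
  have he : ∑ t with F.base t = F.base e ∧ F.key t ≤ F.key e, c t = 0 := by
    rw [← CharTwo.add_self_eq_zero (c d)]
    nth_rw 2 [hc]
    rw [← Finset.sum_pair hde]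
    congr 1
    grind
  rw [leftParity, leftParity, hd, he, hb, add_zero, add_right_comm, CharTwo.add_self_eq_zero,
    zero_add]

end Parity

end SegmentFamily

section CyclicSuccessor

theorem sameCycle_map {A B : Type*} {σ : Equiv.Perm A} {τ : Equiv.Perm B} {f : A → B}
    (hf : Function.Semiconj f σ τ) {a b : A} (h : σ.SameCycle a b) :
    τ.SameCycle (f a) (f b) := by
  obtain ⟨k, rfl⟩ := h
  have hiterate (n : ℕ) (a : A) : f ((σ ^ n) a) = (τ ^ n) (f a) := by
    rw [Equiv.Perm.coe_pow, Equiv.Perm.coe_pow]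
    exact hf.iterate_right n a
  obtain ⟨n, rfl | rfl⟩ := k.eq_nat_or_neg
  · exact ⟨n, by rw [zpow_natCast, zpow_natCast, hiterate]⟩
  · refine ⟨-n, ?_⟩
    rw [zpow_neg, zpow_neg, zpow_natCast, zpow_natCast, Equiv.Perm.inv_eq_iff_eq, ← hiterate,
      ← Equiv.Perm.mul_apply, mul_inv_cancel, Equiv.Perm.one_apply]

theorem sameCycle_finRotate {n : ℕ} (i j : Fin n) : (finRotate n).SameCycle i j := by
  obtain _ | _ | n := n
  · exact i.elim0
  · rw [Fin.eq_zero i, Fin.eq_zero j]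
  · have hsupp (k : Fin (n + 2)) : finRotate (n + 2) k ≠ k := by
      rw [← Equiv.Perm.mem_support, support_finRotate]
      exact Finset.mem_univ k
    exact isCycle_finRotate.sameCycle (hsupp i) (hsupp j)

variable {M : Type*} [AddCommMonoid M]

theorem sum_Iic_finRotate {n : ℕ} {c : Fin n → M} (hc : ∑ i, c i = 0) (j : Fin n) :
    ∑ i ∈ Finset.Iic (finRotate n j), c i = ∑ i ∈ Finset.Iic j, c i + c (finRotate n j) := by
  obtain - | n := n
  · exact j.elim0
  rcases eq_or_ne j (Fin.last n) with rfl | hj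
  · have hfirst : Finset.Iic (0 : Fin (n + 1)) = {0} := Finset.Iic_bot
    have hlast : Finset.Iic (Fin.last n) = Finset.univ := Finset.Iic_top
    rw [finRotate_last, hfirst, hlast, hc, zero_add, Finset.sum_singleton]
  · have hval : (finRotate (n + 1) j : ℕ) = j + 1 := coe_finRotate_of_ne_last hj
    have hinsert : Finset.Iic (finRotate (n + 1) j) =
        insert (finRotate (n + 1) j) (Finset.Iic j) := by
      ext i
      simp only [Finset.mem_Iic, Finset.mem_insert, Fin.le_def, Fin.ext_iff, hval]
      omega
    rw [hinsert, Finset.sum_insert (by rw [Finset.mem_Iic, Fin.le_def, hval]; omega), add_comm]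

variable {A K : Type*} [LinearOrder K] {key : A → K}

theorem exists_perm_sum_key_le (M) [AddCommMonoid M] [Fintype A]
    (hkey : Function.Injective key) :
    ∃ σ : Equiv.Perm A, (∀ a b, σ.SameCycle a b) ∧ ∀ c : A → M, ∑ a, c a = 0 → ∀ a,
      ∑ b with key b ≤ key (σ a), c b = ∑ b with key b ≤ key a, c b + c (σ a) := by
  let _ : LinearOrder A := LinearOrder.lift' key hkey
  let e : Fin (Fintype.card A) ≃o A := Fintype.orderIsoFinOfCardEq A rfl
  have hsum (c : A → M) (i) :
      ∑ b with key b ≤ key (e i), c b = ∑ k ∈ Finset.Iic i, c (e k) := by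
    refine (Finset.sum_bijective e e.bijective (fun k => ?_) fun _ _ => rfl).symm
    rw [Finset.mem_Iic, Finset.mem_filter_univ]
    exact e.le_iff_le.symm
  refine ⟨e.toEquiv.permCongr (finRotate _), fun a b => ?_, fun c hc a => ?_⟩
  · have hconj : Function.Semiconj e (finRotate _) (e.toEquiv.permCongr (finRotate _)) :=
      fun i => by simp
    simpa using sameCycle_map hconj (sameCycle_finRotate (e.symm a) (e.symm b))
  · obtain ⟨i, rfl⟩ := e.surjective a
    have hrot : e.toEquiv.permCongr (finRotate _) (e i) = e (finRotate _ i) := by simp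
    rw [hrot, hsum, hsum]
    exact sum_Iic_finRotate ((e.toEquiv.sum_comp c).trans hc) i

/-- The permutation runs cyclically through each fibre of `f` in the order given by `key`. -/
theorem exists_perm_fiber_sum_key_le {B : Type*} [Fintype A] [DecidableEq B] (M)
    [AddCommMonoid M] {f : A → B} (hkey : ∀ a b, f a = f b → key a = key b → a = b) :
    ∃ σ : Equiv.Perm A, (∀ a, f (σ a) = f a) ∧ (∀ a b, f a = f b → σ.SameCycle a b) ∧
      ∀ c : A → M, (∀ v, ∑ a with f a = v, c a = 0) → ∀ a,
        ∑ b with f b = f a ∧ key b ≤ key (σ a), c b =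
          ∑ b with f b = f a ∧ key b ≤ key a, c b + c (σ a) := by
  have hfiber (v : B) := exists_perm_sum_key_le M (key := fun a : {a // f a = v} => key a)
    fun a b h => Subtype.ext (hkey a b (a.2.trans b.2.symm) h)
  choose τ hcycle hsum using hfiber
  let σ : Equiv.Perm A := (Equiv.sigmaFiberEquiv f).permCongr (Equiv.Perm.sigmaCongrRight τ)
  have hσ (v : B) (a : {a // f a = v}) : σ a = τ v a := by
    obtain ⟨a, rfl⟩ := a
    rfl
  refine ⟨σ, fun a => ?_, fun a b hab => ?_, fun c hc a => ?_⟩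
  · rw [hσ _ ⟨a, rfl⟩]
    exact (τ _ _).2
  · exact sameCycle_map (fun a => (hσ _ a).symm) (hcycle _ ⟨a, hab⟩ ⟨b, rfl⟩)
  · have hsub (p : A → Prop) [DecidablePred p] :
        ∑ b with f b = f a ∧ p b, c b =
          ∑ b ∈ Finset.univ.filter fun b : {b // f b = f a} => p b, c b := by
      rw [← Finset.filter_filter, Finset.sum_filter p,
        Finset.sum_filter fun b : {b // f b = f a} => p b]
      exact Finset.sum_subtype _ (by simp) fun b => if p b then c b else 0
    rw [hsub, hsub, hσ _ ⟨a, rfl⟩]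
    refine hsum _ _ ?_ ⟨a, rfl⟩
    simpa [hc] using (hsub fun _ => True).symm

end CyclicSuccessor

section RotationSystem

variable {V : Type*} (G : SimpleGraph V)

/-- A rotation system: a cyclic order, given by its successor permutation `rot`, of the darts that
leave each vertex. It records how the edges of a drawing of `G` are arranged around the
vertices. -/
structure RotationSystem where
  rot : Equiv.Perm G.Dart
  rot_fst : ∀ d, (rot d).fst = d.fst
  sameCycle : ∀ d d' : G.Dart, d.fst = d'.fst → rot.SameCycle d d'

/-- The reversal of darts as a permutation. -/
def dartReverse : Equiv.Perm G.Dart :=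
  ⟨Dart.symm, Dart.symm, Dart.symm_symm, Dart.symm_symm⟩

variable {G}

/-- The permutation of the darts whose cycles are the boundary walks of the faces, traversed with
the face on the left when `rot` is the counterclockwise order. -/
def RotationSystem.face (ρ : RotationSystem G) : Equiv.Perm G.Dart :=
  ρ.rot⁻¹ * dartReverse G

theorem RotationSystem.face_apply (ρ : RotationSystem G) (d : G.Dart) :
    ρ.face d = ρ.rot⁻¹ d.symm := rfl

theorem RotationSystem.rot_face (ρ : RotationSystem G) (d : G.Dart) : ρ.rot (ρ.face d) = d.symm :=
  ρ.rot.apply_symm_apply _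

/-- The faces of a rotation system, encoded as the cycles of the face permutation. Isolated
vertices contribute no face. -/
abbrev RotationSystem.Face (ρ : RotationSystem G) : Type _ :=
  Quotient (Equiv.Perm.SameCycle.setoid ρ.face)

end RotationSystem

section EulerInequality

variable {V : Type*} {G : SimpleGraph V}

/-- The edge of a dart, as an element of the edge set. -/
def dartEdge (d : G.Dart) : G.edgeSet := ⟨d.edge, d.edge_mem⟩

theorem dartEdge_symm (d : G.Dart) : dartEdge d.symm = dartEdge d := Subtype.ext d.edge_symm

theorem dartEdge_surjective : Function.Surjective (dartEdge (G := G)) := by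
  rintro ⟨e, he⟩
  induction e with
  | _ u v => exact ⟨⟨(u, v), he⟩, rfl⟩

theorem eq_of_sameCycle {A B : Type*} {φ : Equiv.Perm A} {g : A → B} (hg : ∀ a, g (φ a) = g a)
    {a b : A} (h : φ.SameCycle a b) : g a = g b :=
  Equiv.Perm.sameCycle_one.1 (sameCycle_map (τ := 1) hg h)

theorem finrank_ker_sum_proj (k : Type*) [Field k] [Fintype V] [Nonempty V] :
    Module.finrank k (LinearMap.ker (∑ v : V, LinearMap.proj v : (V → k) →ₗ[k] k)) + 1 =
      Fintype.card V := by
  classical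
  set s : (V → k) →ₗ[k] k := ∑ v, LinearMap.proj v
  have hsurj : Function.Surjective s := fun a =>
    ⟨Pi.single (Classical.arbitrary V) a, by simp [s]⟩
  have h := s.finrank_range_add_finrank_ker
  rw [LinearMap.range_eq_top.2 hsurj, finrank_top, Module.finrank_self,
    Module.finrank_fintype_fun_eq_card] at h
  rw [← h, add_comm]

variable [Fintype V] [DecidableEq V] [DecidableRel G.Adj]

variable (G) in
/-- The boundary modulo 2 of a set of edges; its kernel is the cycle space of `G`. -/
def edgeBoundary : (G.edgeSet → ZMod 2) →ₗ[ZMod 2] (V → ZMod 2) :=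
  LinearMap.pi fun v => ∑ d : G.Dart with d.fst = v, LinearMap.proj (dartEdge d)

theorem edgeBoundary_apply (c : G.edgeSet → ZMod 2) (v : V) :
    edgeBoundary G c v = ∑ d : G.Dart with d.fst = v, c (dartEdge d) := by
  simp [edgeBoundary]

theorem sum_edgeBoundary (c : G.edgeSet → ZMod 2) : ∑ v, edgeBoundary G c v = 0 := by
  simp only [edgeBoundary_apply]
  rw [Finset.sum_fiberwise]
  refine Finset.sum_involution (fun d _ => d.symm) (fun d _ => ?_) (fun d _ _ => d.symm_ne)
    (fun _ _ => Finset.mem_univ _) fun d _ => d.symm_symm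
  rw [dartEdge_symm, CharTwo.add_self_eq_zero]

theorem card_edgeFinset_add_one_le_add_finrank_ker [Nonempty V] :
    G.edgeFinset.card + 1 ≤
      Fintype.card V + Module.finrank (ZMod 2) (LinearMap.ker (edgeBoundary G)) := by
  have hrange : LinearMap.range (edgeBoundary G) ≤
      LinearMap.ker (∑ v : V, LinearMap.proj v : (V → ZMod 2) →ₗ[ZMod 2] ZMod 2) := by
    rintro _ ⟨c, rfl⟩
    rw [LinearMap.mem_ker, LinearMap.sum_apply]
    exact sum_edgeBoundary c
  have hrank := (edgeBoundary G).finrank_range_add_finrank_ker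
  rw [Module.finrank_fintype_fun_eq_card, ← Set.toFinset_card] at hrank
  have hsum := finrank_ker_sum_proj (V := V) (ZMod 2)
  have hle := Submodule.finrank_mono hrange
  change G.edgeSet.toFinset.card + 1 ≤ _
  omega

/-- A 2-coloring `g` of the faces has the set of edges with differently colored sides as its
boundary, so the hypothesis makes the colorings at least as many as the cycles. -/
theorem finrank_ker_edgeBoundary_le (φ : Equiv.Perm G.Dart)
    (h : ∀ c : G.edgeSet → ZMod 2, edgeBoundary G c = 0 →
      ∃ g : G.Dart → ZMod 2, (∀ d, g (φ d) = g d) ∧ ∀ d, g d + g d.symm = c (dartEdge d)) :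
    Module.finrank (ZMod 2) (LinearMap.ker (edgeBoundary G)) ≤
      Nat.card (Quotient (Equiv.Perm.SameCycle.setoid φ)) := by
  let Q := Quotient (Equiv.Perm.SameCycle.setoid φ)
  have _ : Fintype Q := Fintype.ofFinite Q
  let color (d : G.Dart) : (Q → ZMod 2) →ₗ[ZMod 2] ZMod 2 := LinearMap.proj (Quotient.mk _ d)
  let sides : (Q → ZMod 2) →ₗ[ZMod 2] (G.Dart → ZMod 2) :=
    LinearMap.pi fun d => color d + color d.symm
  let pullback := LinearMap.funLeft (ZMod 2) (ZMod 2) (dartEdge (G := G))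
  have hpullback : Function.Injective pullback :=
    LinearMap.funLeft_injective_of_surjective _ _ _ dartEdge_surjective
  have hle : (LinearMap.ker (edgeBoundary G)).map pullback ≤ LinearMap.range sides := by
    rintro _ ⟨c, hc, rfl⟩
    obtain ⟨g, hinv, hg⟩ := h c hc
    exact ⟨Quotient.lift g fun _ _ => eq_of_sameCycle hinv, funext hg⟩
  calc Module.finrank (ZMod 2) (LinearMap.ker (edgeBoundary G))
      = Module.finrank (ZMod 2) ((LinearMap.ker (edgeBoundary G)).map pullback) :=
        (Submodule.equivMapOfInjective pullback hpullback _).finrank_eq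
    _ ≤ Module.finrank (ZMod 2) (LinearMap.range sides) := Submodule.finrank_mono hle
    _ ≤ Module.finrank (ZMod 2) (Q → ZMod 2) := sides.finrank_range_le
    _ = Nat.card Q := by rw [Module.finrank_fintype_fun_eq_card, Nat.card_eq_fintype_card]

end EulerInequality

section Polyline

/-- `bend 0, …, bend n` are the successive bends of a simple polygonal arc in `A` from `a`
to `b`. -/
structure IsPolyline (a b : Plane) (A : Set Plane) (n : ℕ) (bend : ℕ → Plane) : Prop where
  pos : 0 < n
  first : bend 0 = a
  last : bend n = b
  injOn : Set.InjOn bend (Set.Iic n)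
  eq_or_eq_of_mem : ∀ i < n, ∀ j < n, i ≠ j → ∀ z ∈ segment ℝ (bend i) (bend (i + 1)),
    z ∈ segment ℝ (bend j) (bend (j + 1)) → z = bend i ∨ z = bend (i + 1)
  segment_subset : ∀ i < n, segment ℝ (bend i) (bend (i + 1)) ⊆ A

variable {a b : Plane} {A : Set Plane} {n : ℕ} {bend : ℕ → Plane}

theorem exists_isPolyline (h : IsArc a b A) : ∃ n bend, IsPolyline a b A n bend := by
  obtain ⟨n, p, hn, hfirst, hlast, hne, hconsecutive, hdisjoint, rfl⟩ := h
  have hmeet {i j : ℕ} (hij : i < j) (hj : j < n) {z : Plane}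
      (hzi : z ∈ segment ℝ (p i) (p (i + 1))) (hzj : z ∈ segment ℝ (p j) (p (j + 1))) :
      z = p (i + 1) ∧ z = p j := by
    rcases (Nat.succ_le_of_lt hij).eq_or_lt with rfl | hlt
    · have hz := (hconsecutive i hj).subset ⟨hzi, hzj⟩
      exact ⟨hz, hz⟩
    · exact absurd hzj (Set.disjoint_left.1 (hdisjoint i j hlt hj) hzi)
  have hlt {i j : ℕ} (hij : i < j) (hj : j ≤ n) : p i ≠ p j := by
    obtain ⟨k, rfl⟩ := Nat.exists_eq_add_of_lt hij
    intro heq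
    rcases Nat.eq_zero_or_pos k with rfl | hk
    · exact hne i hj heq
    · exact hne i (hij.trans_le hj) (hmeet (j := i + k) (by omega) hj (left_mem_segment ℝ _ _)
        (heq ▸ right_mem_segment ℝ _ _)).1
  refine ⟨n, p, hn, hfirst, hlast, fun i hi j hj heq => ?_, fun i hi j hj hij z hzi hzj => ?_,
    fun i hi => Set.subset_biUnion_of_mem (u := fun i => segment ℝ (p i) (p (i + 1))) hi⟩
  · rcases lt_trichotomy i j with hij | hij | hij
    · exact absurd heq (hlt hij hj)
    · exact hij
    · exact absurd heq.symm (hlt hij hi)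
  · rcases hij.lt_or_gt with hij | hij
    · exact Or.inr (hmeet hij hj hzi hzj).1
    · exact Or.inl (hmeet hij hi hzj hzi).2

namespace IsPolyline

theorem reverse (h : IsPolyline a b A n bend) :
    IsPolyline b a A n fun i => bend (n - i) := by
  have hsegment {i : ℕ} (hi : i < n) : segment ℝ (bend (n - i)) (bend (n - (i + 1))) =
      segment ℝ (bend (n - 1 - i)) (bend (n - 1 - i + 1)) := by
    rw [segment_symm]
    congr 2 <;> omega
  refine ⟨h.pos, by simp [h.last], by simp [h.first], fun i hi j hj heq => ?_,
    fun i hi j hj hij z hzi hzj => ?_, fun i hi => ?_⟩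
  · have hsub := h.injOn (Nat.sub_le n i) (Nat.sub_le n j) heq
    rw [Set.mem_Iic] at hi hj
    omega
  · rw [hsegment hi] at hzi
    rw [hsegment hj] at hzj
    have hz := h.eq_or_eq_of_mem _ (by omega) _ (by omega) (by omega) z hzi hzj
    rwa [or_comm, show n - 1 - i + 1 = n - i by omega,
      show n - 1 - i = n - (i + 1) by omega] at hz
  · rw [hsegment hi]
    exact h.segment_subset _ (by omega)

variable (h : IsPolyline a b A n bend) {i : ℕ}
include h

theorem bend_mem (hi : i ≤ n) : bend i ∈ A := by
  rcases hi.lt_or_eq with hi | rfl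
  · exact h.segment_subset i hi (left_mem_segment ℝ _ _)
  · have hpos := h.pos
    have hmem := h.segment_subset (i - 1) (by omega) (right_mem_segment ℝ _ _)
    rwa [Nat.sub_add_cancel hpos] at hmem

theorem eq_or_eq_of_end_mem (hi : i < n) {z : Plane} (hz : z = a ∨ z = b)
    (hmem : z ∈ segment ℝ (bend i) (bend (i + 1))) : z = bend i ∨ z = bend (i + 1) := by
  rcases hz with rfl | rfl
  · rcases eq_or_ne i 0 with rfl | hi0
    · exact Or.inl h.first.symm
    · exact h.eq_or_eq_of_mem i hi 0 h.pos hi0 z hmem (h.first ▸ left_mem_segment ℝ _ _)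
  · obtain ⟨m, rfl⟩ := Nat.exists_eq_succ_of_ne_zero h.pos.ne'
    rcases eq_or_ne i m with rfl | him
    · exact Or.inr h.last.symm
    · exact h.eq_or_eq_of_mem i hi m m.lt_succ_self him z hmem
        (h.last ▸ right_mem_segment ℝ _ _)

end IsPolyline

end Polyline

theorem exists_injOn_skew {S : Set Plane} (hS : S.Finite) :
    ∃ ε : ℝ, Set.InjOn (fun p : Plane => p 0 + ε * p 1) S := by
  obtain ⟨ε, hε⟩ := (hS.image2 (fun p q : Plane => -(p 0 - q 0) / (p 1 - q 1))
    hS).infinite_compl.nonempty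
  refine ⟨ε, fun p hp q hq heq => ?_⟩
  dsimp only at heq
  by_cases h1 : p 1 = q 1
  · ext i
    fin_cases i
    · rw [h1] at heq
      exact add_right_cancel heq
    · exact h1
  · refine absurd ⟨p, hp, q, hq, ?_⟩ hε
    rw [div_eq_iff (sub_ne_zero.2 h1)]
    linear_combination -heq

section Drawing

/-- A plane drawing with chosen bends on every edge, listed along each of the two darts of
the edge. -/
structure PolygonalDrawing {V : Type*} (G : SimpleGraph V) extends PlaneDrawing G where
  len : G.Dart → ℕ
  bend : G.Dart → ℕ → Plane
  isPolyline : ∀ d, IsPolyline (pos d.fst) (pos d.snd) (arc d.edge) (len d) (bend d)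
  len_symm : ∀ d, len d.symm = len d
  bend_symm : ∀ d, ∀ i ≤ len d, bend d.symm i = bend d (len d - i)

variable {V : Type*} {G : SimpleGraph V}

theorem exists_polygonalDrawing (hG : G.IsPlanar) : Nonempty (PolygonalDrawing G) := by
  classical
  obtain ⟨D⟩ := hG
  choose out hout using dartEdge_surjective (G := G)
  choose len bend hbend using fun e => exists_isPolyline (D.isArc _ _ (out e).adj)
  have hor (d : G.Dart) : out (dartEdge d) = d ∨ out (dartEdge d) = d.symm :=
    (dart_edge_eq_iff _ _).1 (congrArg Subtype.val (hout (dartEdge d)))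
  have hsymm (d : G.Dart) : d.symm = out (dartEdge d) ↔ d ≠ out (dartEdge d) := by
    have := d.symm_ne
    rcases hor d with h | h <;> simp [h, this, this.symm]
  refine ⟨{ D with
    len := fun d => len (dartEdge d)
    bend := fun d i => if d = out (dartEdge d) then bend (dartEdge d) i
      else bend (dartEdge d) (len (dartEdge d) - i)
    isPolyline := fun d => ?_
    len_symm := fun d => by rw [dartEdge_symm]
    bend_symm := fun d i hi => ?_ }⟩
  · have h := hbend (dartEdge d)
    rcases hor d with hd | hd <;> rw [hd] at h
    · simp only [if_pos hd.symm]
      exact h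
    · simp only [if_neg ((hsymm d).1 hd.symm), ← d.edge_symm]
      exact h.reverse
  · simp only [dartEdge_symm, hsymm]
    by_cases h : d = out (dartEdge d)
    · simp [← h]
    · simp [h, Nat.sub_sub_self hi]

namespace PolygonalDrawing

variable (P : PolygonalDrawing G)

/-- The directed straight segments of a drawing: `⟨d, i⟩` is the `i`-th one along the dart `d`. -/
abbrev Seg : Type _ := Σ d : G.Dart, Fin (P.len d)

variable {P}

theorem seg_ext {s t : P.Seg} (hdart : s.1 = t.1) (hindex : (s.2 : ℕ) = t.2) : s = t := by
  obtain ⟨d, i⟩ := s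
  obtain ⟨d', j⟩ := t
  obtain rfl : d = d' := hdart
  rw [show i = j from Fin.ext hindex]

/-- The starting point of a directed segment. -/
def segStart (s : P.Seg) : Plane := P.bend s.1 s.2

/-- A directed segment traversed backwards. -/
def segRev (s : P.Seg) : P.Seg :=
  ⟨s.1.symm, ⟨P.len s.1 - 1 - s.2, by rw [P.len_symm]; omega⟩⟩

theorem segRev_segRev (s : P.Seg) : segRev (segRev s) = s := by
  refine seg_ext s.1.symm_symm ?_
  change P.len s.1.symm - 1 - (P.len s.1 - 1 - s.2) = s.2
  rw [P.len_symm]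
  omega

theorem segStart_segRev (s : P.Seg) : segStart (segRev s) = P.bend s.1 (s.2 + 1) := by
  change P.bend s.1.symm (P.len s.1 - 1 - s.2) = _
  rw [P.bend_symm _ _ (by omega)]
  congr 1
  omega

theorem segment_subset_arc (s : P.Seg) :
    segment ℝ (segStart s) (segStart (segRev s)) ⊆ P.arc s.1.edge := by
  rw [segStart_segRev]
  exact (P.isPolyline s.1).segment_subset s.2 s.2.2

theorem eq_or_eq_of_mem_segment {s t : P.Seg} (hts : t ≠ s) (htr : t ≠ segRev s) {z : Plane}
    (hzs : z ∈ segment ℝ (segStart s) (segStart (segRev s)))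
    (hzt : z ∈ segment ℝ (segStart t) (segStart (segRev t))) :
    z = segStart s ∨ z = segStart (segRev s) := by
  by_cases hedge : s.1.edge = t.1.edge
  · wlog hdart : s.1 = t.1 generalizing t
    · rw [← segRev_segRev t, segRev_segRev (segRev t), segment_symm] at hzt
      exact this (fun h => htr (by rw [← h, segRev_segRev]))
        (fun h => hts (by rw [← segRev_segRev t, h, segRev_segRev])) hzt
        (hedge.trans t.1.edge_symm.symm) (((dart_edge_eq_iff _ _).1 hedge).resolve_left hdart)
    obtain ⟨d, i⟩ := s
    obtain ⟨d', j⟩ := t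
    obtain rfl : d = d' := hdart
    have hij : (i : ℕ) ≠ j := fun h => hts (seg_ext rfl h.symm)
    rw [segStart_segRev] at hzs hzt ⊢
    exact (P.isPolyline d).eq_or_eq_of_mem i i.2 j j.2 hij z hzs hzt
  · obtain ⟨w, hws, -, rfl⟩ := P.arc_inter_arc _ s.1.edge_mem _ t.1.edge_mem hedge z
      ⟨segment_subset_arc s hzs, segment_subset_arc t hzt⟩
    rw [segStart_segRev] at hzs ⊢
    exact (P.isPolyline s.1).eq_or_eq_of_end_mem s.2.2
      ((Sym2.mem_iff.1 hws).imp (congrArg P.pos) (congrArg P.pos)) hzs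

section SegmentFamily

variable [Finite G.Dart]

variable (P) in
/-- The segments of a drawing, seen from a direction in which no two bends line up. -/
noncomputable def segmentFamily : SegmentFamily P.Seg Plane :=
  have hskew := exists_injOn_skew (Set.finite_range (segStart (P := P)))
  { X := (EuclideanSpace.proj 0 + Classical.choose hskew • EuclideanSpace.proj 1 : Plane →L[ℝ] ℝ)
    Y := (EuclideanSpace.proj 1 : Plane →L[ℝ] ℝ)
    coord_ext := fun p q hX hY => by
      have h1 : p 1 = q 1 := hY
      have h0 : p 0 + Classical.choose hskew * p 1 = q 0 + Classical.choose hskew * q 1 := hX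
      ext i
      fin_cases i
      · exact add_right_cancel (h1 ▸ h0)
      · exact h1
    base := segStart
    rev := segRev
    rev_rev := segRev_segRev
    base_rev_ne := fun s h => by
      rw [segStart_segRev] at h
      have hs := (P.isPolyline s.1).injOn (Nat.succ_le_of_lt s.2.2) s.2.2.le h
      omega
    base_eq_of_X_eq := fun s t h =>
      Classical.choose_spec hskew (Set.mem_range_self s) (Set.mem_range_self t) h
    eq_end := fun _ _ hts htr _ => eq_or_eq_of_mem_segment hts htr }

end SegmentFamily

/-- The first directed segment of a dart. -/
def firstSeg (P : PolygonalDrawing G) (d : G.Dart) : P.Seg := ⟨d, ⟨0, (P.isPolyline d).pos⟩⟩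

theorem segStart_firstSeg (d : G.Dart) : segStart (P.firstSeg d) = P.pos d.fst :=
  (P.isPolyline d).first

theorem eq_firstSeg_of_segStart_eq_pos {s : P.Seg} {v : V} (h : segStart s = P.pos v) :
    s = P.firstSeg s.1 ∧ s.1.fst = v := by
  have hs := P.isPolyline s.1
  have hmem : P.pos v ∈ P.arc s.1.edge := h ▸ hs.bend_mem s.2.2.le
  rcases Sym2.mem_iff.1 (P.vertex_on_arc _ s.1.edge_mem v hmem) with rfl | rfl
  · exact ⟨seg_ext rfl (hs.injOn s.2.2.le (Nat.zero_le _) (h.trans hs.first.symm)), rfl⟩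
  · exact absurd (hs.injOn s.2.2.le (Set.mem_Iic.2 le_rfl) (h.trans hs.last.symm)) s.2.2.ne

theorem eq_or_eq_of_segStart_eq {d : G.Dart} {i : ℕ} (hi : i + 1 < P.len d) {t : P.Seg}
    (h : segStart t = P.bend d (i + 1)) :
    t = ⟨d, ⟨i + 1, hi⟩⟩ ∨ t = segRev ⟨d, ⟨i, Nat.lt_of_succ_lt hi⟩⟩ := by
  have hd := P.isPolyline d
  have hedge : t.1.edge = d.edge := by
    by_contra hne
    obtain ⟨w, -, -, hw⟩ := P.arc_inter_arc _ t.1.edge_mem _ d.edge_mem hne (segStart t)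
      ⟨(P.isPolyline t.1).bend_mem t.2.2.le, h ▸ hd.bend_mem hi.le⟩
    have hfirst := (eq_firstSeg_of_segStart_eq_pos (s := ⟨d, ⟨i + 1, hi⟩⟩) (h.symm.trans hw)).1
    exact i.succ_ne_zero (congrArg (fun s : P.Seg => (s.2 : ℕ)) hfirst)
  obtain ⟨d', j⟩ := t
  rcases (dart_edge_eq_iff d' d).1 hedge with rfl | rfl
  · exact Or.inl (seg_ext rfl (hd.injOn j.2.le hi.le h))
  · have hj : (j : ℕ) < P.len d := P.len_symm d ▸ j.2
    rw [segStart, P.bend_symm _ _ hj.le] at h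
    have hindex := hd.injOn (Nat.sub_le _ _) hi.le h
    refine Or.inr (seg_ext rfl ?_)
    change (j : ℕ) = P.len d - 1 - i
    omega

section Parity

variable [Fintype V] [DecidableEq V] [DecidableRel G.Adj] {c : G.edgeSet → ZMod 2}

/-- The function on segments induced by a function on edges. -/
def segColor (P : PolygonalDrawing G) (c : G.edgeSet → ZMod 2) (s : P.Seg) : ZMod 2 :=
  c (dartEdge s.1)

open Classical in
theorem sum_segColor_segStart_eq_pos (c : G.edgeSet → ZMod 2) (v : V) (p : P.Seg → Prop) :
    ∑ s with segStart s = P.pos v ∧ p s, P.segColor c s =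
      ∑ d with d.fst = v ∧ p (P.firstSeg d), c (dartEdge d) := by
  have hfirst {s : P.Seg} (hs : s ∈ Finset.univ.filter fun s => segStart s = P.pos v ∧ p s) :=
    eq_firstSeg_of_segStart_eq_pos (Finset.mem_filter.1 hs).2.1
  refine Finset.sum_nbij' Sigma.fst P.firstSeg (fun s hs => ?_) (fun d hd => ?_)
    (fun s hs => (hfirst hs).1.symm) (fun _ _ => rfl) fun _ _ => rfl
  · rw [Finset.mem_filter_univ, ← (hfirst hs).1]
    exact ⟨(hfirst hs).2, (Finset.mem_filter.1 hs).2.2⟩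
  · obtain ⟨rfl, hp⟩ := (Finset.mem_filter.1 hd).2
    exact Finset.mem_filter.2 ⟨Finset.mem_univ _, segStart_firstSeg d, hp⟩

theorem isCycle_segColor (hc : edgeBoundary G c = 0) :
    P.segmentFamily.IsCycle (P.segColor c) := by
  classical
  refine ⟨fun s => congrArg c (dartEdge_symm s.1), fun q => ?_⟩
  suffices h : ∑ s with segStart s = q, P.segColor c s = 0 by
    convert h
    rfl
  by_cases hvertex : ∃ v, q = P.pos v
  · obtain ⟨v, rfl⟩ := hvertex
    have hv := congrFun hc v
    rw [edgeBoundary_apply, Pi.zero_apply] at hv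
    simpa [hv] using sum_segColor_segStart_eq_pos c v fun _ => True
  rcases (Finset.univ.filter fun s : P.Seg => segStart s = q).eq_empty_or_nonempty with
    hempty | ⟨⟨d, i, hi⟩, hmem⟩
  · rw [hempty, Finset.sum_empty]
  obtain rfl := (Finset.mem_filter_univ _).1 hmem
  obtain _ | i := i
  · exact absurd ⟨_, segStart_firstSeg d⟩ hvertex
  set s : P.Seg := ⟨d, ⟨i + 1, hi⟩⟩
  set t : P.Seg := segRev ⟨d, ⟨i, Nat.lt_of_succ_lt hi⟩⟩
  have hst : s ≠ t := fun h => d.symm_ne (congrArg Sigma.fst h).symm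
  have hpair : (Finset.univ.filter fun u => segStart u = segStart s) = {s, t} := by
    ext u
    rw [Finset.mem_filter_univ, Finset.mem_insert, Finset.mem_singleton]
    refine ⟨eq_or_eq_of_segStart_eq hi, ?_⟩
    rintro (rfl | rfl)
    · rfl
    · exact segStart_segRev _
  rw [hpair, Finset.sum_pair hst]
  change c (dartEdge d) + c (dartEdge d.symm) = 0
  rw [dartEdge_symm, CharTwo.add_self_eq_zero]

theorem leftParity_eq_firstSeg (hc : edgeBoundary G c = 0) (s : P.Seg) :
    P.segmentFamily.leftParity (P.segColor c) s =
      P.segmentFamily.leftParity (P.segColor c) (P.firstSeg s.1) := by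
  obtain ⟨d, i, hi⟩ := s
  induction i with
  | zero => rfl
  | succ i ih =>
    rw [← ih (Nat.lt_of_succ_lt hi)]
    have hrev := (isCycle_segColor (P := P) hc).leftParity_add_rev
      ⟨d, ⟨i, Nat.lt_of_succ_lt hi⟩⟩
    have hne : (⟨d, ⟨i + 1, hi⟩⟩ : P.Seg) ≠ segRev ⟨d, ⟨i, Nat.lt_of_succ_lt hi⟩⟩ :=
      fun h => d.symm_ne (congrArg Sigma.fst h).symm
    have hpair := P.segmentFamily.leftParity_add_of_pair (c := P.segColor c) hne
      (segStart_segRev ⟨d, ⟨i, Nat.lt_of_succ_lt hi⟩⟩).symm (fun t => eq_or_eq_of_segStart_eq hi)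
      (congrArg c (dartEdge_symm d).symm)
    exact add_right_cancel (hpair.trans hrev.symm)

theorem leftParity_firstSeg_add_symm (hc : edgeBoundary G c = 0) (d : G.Dart) :
    P.segmentFamily.leftParity (P.segColor c) (P.firstSeg d) +
      P.segmentFamily.leftParity (P.segColor c) (P.firstSeg d.symm) = c (dartEdge d) := by
  have hpos := (P.isPolyline d).pos
  set lastSeg : P.Seg := ⟨d, ⟨P.len d - 1, Nat.sub_lt hpos Nat.one_pos⟩⟩
  have hrev : segRev lastSeg = P.firstSeg d.symm := seg_ext rfl (Nat.sub_self _)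
  rw [← hrev, ← leftParity_eq_firstSeg hc lastSeg]
  exact (isCycle_segColor hc).leftParity_add_rev lastSeg

end Parity

end PolygonalDrawing

open PolygonalDrawing in
/-- The faces of the rotation system in which the darts at a vertex are ordered by the directions
of their first segments satisfy Euler's formula as an inequality: every cycle of the graph is the
boundary of the set of faces whose left parity is odd. -/
theorem exists_rotationSystem_euler [Fintype V] [Nonempty V] [DecidableRel G.Adj]
    (hG : G.IsPlanar) : ∃ ρ : RotationSystem G,
      G.edgeFinset.card + 1 ≤ Fintype.card V + Nat.card ρ.Face := by
  classical
  obtain ⟨P⟩ := exists_polygonalDrawing hG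
  let F := P.segmentFamily
  obtain ⟨σ, hfst, hcycle, hsum⟩ := exists_perm_fiber_sum_key_le (ZMod 2)
    (f := fun d : G.Dart => d.fst) (key := fun d => F.key (P.firstSeg d)) fun d e hde hkey =>
      congrArg Sigma.fst (F.eq_of_key_eq (d := P.firstSeg d) (e := P.firstSeg e)
        ((segStart_firstSeg d).trans (hde ▸ (segStart_firstSeg e).symm)) hkey)
  let ρ : RotationSystem G := ⟨σ, hfst, hcycle⟩
  refine ⟨ρ, card_edgeFinset_add_one_le_add_finrank_ker.trans
    (Nat.add_le_add_left (finrank_ker_edgeBoundary_le ρ.face fun c hc => ?_) _)⟩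
  let g (d : G.Dart) : ZMod 2 := F.leftParity (P.segColor c) (P.firstSeg d)
  have hg (d : G.Dart) : g d + g d.symm = c (dartEdge d) := leftParity_firstSeg_add_symm hc d
  have hbase (d : G.Dart) : F.base (P.firstSeg d) = P.pos d.fst := segStart_firstSeg d
  have hrot (d : G.Dart) : g (σ d) = g d + c (dartEdge (σ d)) := by
    have hd := hsum (fun d => c (dartEdge d))
      (fun v => (edgeBoundary_apply c v).symm.trans (congrFun hc v)) d
    have hleft (e : G.Dart) (he : e.fst = d.fst) : g e = F.belowParity (P.segColor c)
        (P.pos d.fst) + ∑ e' with e'.fst = d.fst ∧ F.key (P.firstSeg e') ≤ F.key (P.firstSeg e),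
          c (dartEdge e') := by
      simp only [g, SegmentFamily.leftParity, hbase, he]
      congr 1
      convert sum_segColor_segStart_eq_pos c d.fst fun s : P.Seg => F.key s ≤ F.key (P.firstSeg e)
      rfl
    rw [hleft d rfl, hleft (σ d) (hfst d), hd, add_assoc]
  refine ⟨g, fun d => ?_, hg⟩
  have hface := hrot (ρ.face d)
  rw [show σ (ρ.face d) = d.symm from ρ.rot_face d, dartEdge_symm, ← hg d] at hface
  linear_combination -hface - CharTwo.add_self_eq_zero (g d)

end Drawing

theorem le_card_sameCycle {A : Type*} [Fintype A] {φ : Equiv.Perm A} [DecidableRel φ.SameCycle]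
    {a : A} {n : ℕ} (h : ∀ k < n, 0 < k → (φ ^ k) a ≠ a) :
    n ≤ (Finset.univ.filter (φ.SameCycle a)).card := by
  have hlt {i j : ℕ} (hij : i < j) (hj : j < n) : (φ ^ i) a ≠ (φ ^ j) a := fun heq => by
    rw [← Nat.add_sub_cancel' hij.le, pow_add, Equiv.Perm.mul_apply] at heq
    exact h (j - i) (by omega) (by omega) ((φ ^ i).injective heq).symm
  rw [← Finset.card_range n]
  refine Finset.card_le_card_of_injOn (fun k => (φ ^ k) a)
    (fun k _ => Finset.mem_coe.2 ((Finset.mem_filter_univ _).2 ⟨k, zpow_natCast φ k ▸ rfl⟩))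
    fun i hi j hj heq => ?_
  rw [Finset.coe_range, Set.mem_Iio] at hi hj
  rcases lt_trichotomy i j with hij | hij | hij
  · exact absurd heq (hlt hij hj)
  · exact hij
  · exact absurd heq.symm (hlt hij hi)

section DartsAt

variable {V : Type*} {G : SimpleGraph V} [Fintype V] [DecidableRel G.Adj]

open Classical in
variable (G) in
/-- The darts that start at a vertex. -/
noncomputable def dartsAt (v : V) : Finset G.Dart := {d | d.fst = v}

variable {v : V} {d d' : G.Dart}

theorem mem_dartsAt : d ∈ dartsAt G v ↔ d.fst = v := by simp only [dartsAt, Finset.mem_filter_univ]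

theorem mem_dartsAt_fst (d : G.Dart) : d ∈ dartsAt G d.fst := mem_dartsAt.2 rfl

theorem card_dartsAt (v : V) : (dartsAt G v).card = G.degree v := by
  classical
  rw [← G.dart_fst_fiber_card_eq_degree v, dartsAt]

theorem eq_of_mem_dartsAt (h : d ∈ dartsAt G v) (h' : d' ∈ dartsAt G v) (hsnd : d.snd = d'.snd) :
    d = d' :=
  Dart.ext _ _ (Prod.ext ((mem_dartsAt.1 h).trans (mem_dartsAt.1 h').symm) hsnd)

theorem adj_of_mem_dartsAt (h : d ∈ dartsAt G v) : G.Adj v d.snd := mem_dartsAt.1 h ▸ d.adj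

theorem card_filter_dartsAt (v : V) (p : V → Prop) [DecidablePred p] :
    ((dartsAt G v).filter fun d => p d.snd).card = ((G.neighborFinset v).filter p).card := by
  refine Finset.card_bij (fun d _ => d.snd) (fun d hd => ?_) (fun d hd d' hd' h => ?_)
    fun w hw => ?_
  · rw [Finset.mem_filter] at hd
    exact Finset.mem_filter.2 ⟨(G.mem_neighborFinset v _).2 (adj_of_mem_dartsAt hd.1), hd.2⟩
  · exact eq_of_mem_dartsAt (Finset.mem_filter.1 hd).1 (Finset.mem_filter.1 hd').1 h
  · rw [Finset.mem_filter, mem_neighborFinset] at hw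
    exact ⟨⟨(v, w), hw.1⟩, Finset.mem_filter.2 ⟨mem_dartsAt.2 rfl, hw.2⟩, rfl⟩

theorem sum_sum_dartsAt {M : Type*} [AddCommMonoid M] (f : G.Dart → M) :
    ∑ v, ∑ d ∈ dartsAt G v, f d = ∑ d, f d := by
  classical
  rw [← Finset.sum_fiberwise Finset.univ (fun d : G.Dart => d.fst) f]
  rfl

end DartsAt

namespace RotationSystem

variable {V : Type*} {G : SimpleGraph V} (ρ : RotationSystem G)

theorem rot_inv_rot (d : G.Dart) : ρ.rot⁻¹ (ρ.rot d) = d := ρ.rot.symm_apply_apply d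

theorem rot_rot_inv (d : G.Dart) : ρ.rot (ρ.rot⁻¹ d) = d := ρ.rot.apply_symm_apply d

theorem rot_inv_fst (d : G.Dart) : (ρ.rot⁻¹ d).fst = d.fst := by
  rw [← ρ.rot_fst, rot_rot_inv]

theorem face_fst (d : G.Dart) : (ρ.face d).fst = d.snd := ρ.rot_inv_fst d.symm

theorem face_ne (d : G.Dart) : ρ.face d ≠ d := fun h =>
  d.adj.ne ((congrArg (fun e : G.Dart => e.fst) h).symm.trans (ρ.face_fst d))

open Classical in
/-- The indicator of the darts whose face is not a triangle. The corner between `d` and `rot d`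
belongs to the face of `d`. -/
noncomputable def gap (d : G.Dart) : ℚ := if (ρ.face ^ 3) d = d then 0 else 1

variable {ρ} in
theorem gap_eq_one_iff {d : G.Dart} : ρ.gap d = 1 ↔ (ρ.face ^ 3) d ≠ d := by
  rw [gap]
  split_ifs with h <;> simp [h]

theorem gap_eq_zero_or_one (d : G.Dart) : ρ.gap d = 0 ∨ ρ.gap d = 1 := by
  rw [gap]
  split_ifs <;> simp

theorem gap_nonneg (d : G.Dart) : 0 ≤ ρ.gap d := by
  rcases ρ.gap_eq_zero_or_one d with h | h <;> norm_num [h]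

theorem gap_le_one (d : G.Dart) : ρ.gap d ≤ 1 := by
  rcases ρ.gap_eq_zero_or_one d with h | h <;> norm_num [h]

theorem gap_face (d : G.Dart) : ρ.gap (ρ.face d) = ρ.gap d := by
  have h : (ρ.face ^ 3) (ρ.face d) = ρ.face d ↔ (ρ.face ^ 3) d = d := by
    rw [← Equiv.Perm.mul_apply, ← pow_succ, pow_succ', Equiv.Perm.mul_apply,
      ρ.face.injective.eq_iff]
  classical
  exact if_congr h rfl rfl

theorem gap_rot_inv (d : G.Dart) : ρ.gap (ρ.rot⁻¹ d) = ρ.gap d.symm := by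
  rw [← ρ.gap_face d.symm, face_apply, Dart.symm_symm]

theorem gap_eq_one_or_adj (d : G.Dart) :
    ρ.gap d = 1 ∨ ρ.gap d = 0 ∧ G.Adj d.snd (ρ.rot d).snd := by
  refine or_iff_not_imp_left.2 fun hgap =>
    ⟨(ρ.gap_eq_zero_or_one d).resolve_right hgap, ?_⟩
  have hface : ρ.face (ρ.face (ρ.face d)) = d := not_not.1 (mt gap_eq_one_iff.2 hgap)
  have hrot : ρ.rot d = (ρ.face (ρ.face d)).symm := by
    conv_lhs => rw [← hface, rot_face]
  have hadj := (ρ.face d).adj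
  rw [ρ.face_fst d, ← ρ.face_fst (ρ.face d)] at hadj
  rw [hrot]
  exact hadj

theorem gap_symm_eq_one_or_adj (d : G.Dart) :
    ρ.gap d.symm = 1 ∨ ρ.gap d.symm = 0 ∧ G.Adj d.snd (ρ.rot⁻¹ d).snd := by
  have h := ρ.gap_eq_one_or_adj (ρ.rot⁻¹ d)
  rwa [gap_rot_inv, rot_rot_inv, G.adj_comm] at h

/-- The number of sides of the edge of a dart on which the face is not a triangle. -/
noncomputable def sides (d : G.Dart) : ℚ := ρ.gap d + ρ.gap d.symm

theorem sides_symm (d : G.Dart) : ρ.sides d.symm = ρ.sides d := by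
  rw [sides, sides, Dart.symm_symm, add_comm]

theorem sides_nonneg (d : G.Dart) : 0 ≤ ρ.sides d :=
  add_nonneg (ρ.gap_nonneg _) (ρ.gap_nonneg _)

theorem sides_le_two (d : G.Dart) : ρ.sides d ≤ 2 := by
  have := ρ.gap_le_one d
  have := ρ.gap_le_one d.symm
  rw [sides]
  linarith

variable [Fintype V] [DecidableRel G.Adj] {v : V} {d e : G.Dart}

theorem rot_mem_dartsAt (hd : d ∈ dartsAt G v) : ρ.rot d ∈ dartsAt G v :=
  mem_dartsAt.2 ((ρ.rot_fst d).trans (mem_dartsAt.1 hd))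

theorem rot_inv_mem_dartsAt (hd : d ∈ dartsAt G v) : ρ.rot⁻¹ d ∈ dartsAt G v :=
  mem_dartsAt.2 ((ρ.rot_inv_fst d).trans (mem_dartsAt.1 hd))

theorem rot_induction {p : G.Dart → Prop} (hrot : ∀ d ∈ dartsAt G v, p d → p (ρ.rot d))
    (hd : d ∈ dartsAt G v) (hp : p d) (he : e ∈ dartsAt G v) : p e := by
  obtain ⟨n, rfl⟩ :=
    (ρ.sameCycle d e ((mem_dartsAt.1 hd).trans (mem_dartsAt.1 he).symm)).exists_nat_pow_eq
  suffices h : (ρ.rot ^ n) d ∈ dartsAt G v ∧ p ((ρ.rot ^ n) d) from h.2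
  clear he
  induction n with
  | zero => exact ⟨hd, hp⟩
  | succ n ih =>
    rw [pow_succ', Equiv.Perm.mul_apply]
    exact ⟨ρ.rot_mem_dartsAt ih.1, hrot _ ih.1 ih.2⟩

theorem sum_rot {M : Type*} [AddCommMonoid M] (v : V) (f : G.Dart → M) :
    ∑ d ∈ dartsAt G v, f (ρ.rot d) = ∑ d ∈ dartsAt G v, f d :=
  Finset.sum_bij' (fun d _ => ρ.rot d) (fun d _ => ρ.rot⁻¹ d) (fun _ => ρ.rot_mem_dartsAt)
    (fun _ => ρ.rot_inv_mem_dartsAt) (fun d _ => ρ.rot_inv_rot d)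
    (fun d _ => ρ.rot_rot_inv d) fun _ _ => rfl

theorem sum_rot_inv {M : Type*} [AddCommMonoid M] (v : V) (f : G.Dart → M) :
    ∑ d ∈ dartsAt G v, f (ρ.rot⁻¹ d) = ∑ d ∈ dartsAt G v, f d := by
  rw [← ρ.sum_rot v fun d => f (ρ.rot⁻¹ d)]
  simp only [rot_inv_rot]

theorem sum_sides_dartsAt (v : V) :
    ∑ d ∈ dartsAt G v, ρ.sides d = 2 * ∑ d ∈ dartsAt G v, ρ.gap d := by
  simp only [sides, ← gap_rot_inv, Finset.sum_add_distrib, ρ.sum_rot_inv v ρ.gap, two_mul]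

theorem sum_sides : ∑ d, ρ.sides d = 2 * ∑ d, ρ.gap d := by
  simp only [← sum_sum_dartsAt, sum_sides_dartsAt, Finset.mul_sum]

theorem rot_ne (hdeg : 2 ≤ G.degree d.fst) : ρ.rot d ≠ d := by
  intro h
  rw [← card_dartsAt] at hdeg
  have heq {e : G.Dart} (he : e ∈ dartsAt G d.fst) : e = d :=
    ρ.rot_induction (p := (· = d)) (fun e _ h' => by rw [h', h]) (mem_dartsAt_fst d) rfl he
  obtain ⟨a, ha, b, hb, hab⟩ := Finset.one_lt_card.1 hdeg
  exact hab ((heq ha).trans (heq hb).symm)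

theorem rot_ne_rot_inv (hdeg : 3 ≤ G.degree d.fst) : ρ.rot d ≠ ρ.rot⁻¹ d := by
  intro h
  classical
  have hsub : dartsAt G d.fst ⊆ {d, ρ.rot d} := fun e he => by
    rw [Finset.mem_insert, Finset.mem_singleton]
    refine ρ.rot_induction (p := fun e => e = d ∨ e = ρ.rot d) ?_ (mem_dartsAt_fst d)
      (Or.inl rfl) he
    rintro e - (rfl | rfl)
    · exact Or.inr rfl
    · exact Or.inl (by rw [h, rot_rot_inv])
  have hcard := (Finset.card_le_card hsub).trans Finset.card_le_two
  rw [card_dartsAt] at hcard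
  omega

theorem sum_le_of_local {f χ : G.Dart → ℚ} {b : ℚ} (h : ∀ d ∈ dartsAt G v,
    f d ≤ b + b / 2 * (χ (ρ.rot d) + χ (ρ.rot⁻¹ d)) - b * χ d) :
    ∑ d ∈ dartsAt G v, f d ≤ b * G.degree v := by
  refine (Finset.sum_le_sum h).trans_eq ?_
  rw [Finset.sum_sub_distrib, Finset.sum_add_distrib, ← Finset.mul_sum, ← Finset.mul_sum,
    Finset.sum_add_distrib, ρ.sum_rot v χ, ρ.sum_rot_inv v χ, Finset.sum_const, card_dartsAt,
    nsmul_eq_mul]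
  ring

theorem card_lt_card_of_odd {A Z : Finset G.Dart} (hodd : Odd (G.degree v))
    (hZ : Z.Nonempty) (hZv : Z ⊆ dartsAt G v) (hAZ : Disjoint A Z)
    (hA : ∀ d ∈ A, ρ.rot d ∈ Z ∧ ρ.rot⁻¹ d ∈ Z) : A.card < Z.card := by
  classical
  have himage : A.image ⇑(ρ.rot⁻¹) ⊆ Z := Finset.image_subset_iff.2 fun d hd => (hA d hd).2
  have hcard : (A.image ⇑(ρ.rot⁻¹)).card = A.card :=
    Finset.card_image_of_injective _ (ρ.rot⁻¹).injective
  refine (hcard ▸ Finset.card_le_card himage).lt_of_ne fun heq => ?_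
  have hZimage : A.image ⇑(ρ.rot⁻¹) = Z := Finset.eq_of_subset_of_card_le himage (by omega)
  have hrot : ∀ d ∈ dartsAt G v, d ∈ A ∪ Z → ρ.rot d ∈ A ∪ Z := fun d _ hd => by
    rcases Finset.mem_union.1 hd with hd | hd
    · exact Finset.mem_union_right _ (hA d hd).1
    · obtain ⟨e, he, rfl⟩ := Finset.mem_image.1 (hZimage ▸ hd)
      exact Finset.mem_union_left _ ((ρ.rot_rot_inv e).symm ▸ he)
  have hAv : A ⊆ dartsAt G v := fun d hd =>
    ρ.rot_inv_rot d ▸ ρ.rot_inv_mem_dartsAt (hZv (hA d hd).1)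
  obtain ⟨z, hz⟩ := hZ
  have hunion : dartsAt G v = A ∪ Z := (Finset.union_subset hAv hZv).antisymm' fun d =>
    ρ.rot_induction hrot (hZv hz) (Finset.mem_union_right _ hz)
  have hsum := Finset.card_union_of_disjoint hAZ
  rw [← hunion, card_dartsAt, heq] at hsum
  exact Nat.not_even_iff_odd.2 hodd ⟨_, hsum⟩

theorem face_face_ne (h : ∀ v, 2 ≤ G.degree v) (d : G.Dart) : ρ.face (ρ.face d) ≠ d := by
  intro heq
  have hsnd : (ρ.face d).snd = d.fst := by rw [← ρ.face_fst (ρ.face d), heq]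
  have hsymm : ρ.face d = d.symm := Dart.ext _ _ (Prod.ext (ρ.face_fst d) hsnd)
  exact ρ.rot_ne (h _) (hsymm ▸ ρ.rot_face d)

open Classical in
theorem six_le_sum_face (h : ∀ v, 2 ≤ G.degree v) (q : ρ.Face) :
    6 ≤ ∑ d : G.Dart with (Quotient.mk _ d : ρ.Face) = q, (2 - ρ.gap d / 2) := by
  obtain ⟨d, rfl⟩ := Quotient.exists_rep q
  have hface (e : G.Dart) : (Quotient.mk _ e : ρ.Face) = Quotient.mk _ d ↔
      ρ.face.SameCycle d e := Quotient.eq.trans Equiv.Perm.sameCycle_comm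
  have hgap : ∀ e ∈ Finset.univ.filter (ρ.face.SameCycle d), 2 - ρ.gap e / 2 =
      2 - ρ.gap d / 2 := fun e he => by
    rw [eq_of_sameCycle ρ.gap_face ((Finset.mem_filter_univ _).1 he)]
  simp only [hface]
  rw [Finset.sum_congr rfl hgap, Finset.sum_const, nsmul_eq_mul]
  have hne : ∀ k < 3, 0 < k → (ρ.face ^ k) d ≠ d := fun k hk hpos => by
    interval_cases k
    · exact ρ.face_ne d
    · exact ρ.face_face_ne h d
  rcases ρ.gap_eq_zero_or_one d with hd | hd
  · have hcard : (3 : ℚ) ≤ (Finset.univ.filter (ρ.face.SameCycle d)).card := by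
      exact_mod_cast le_card_sameCycle hne
    rw [hd]
    linarith
  · have hcard : (4 : ℚ) ≤ (Finset.univ.filter (ρ.face.SameCycle d)).card := by
      exact_mod_cast le_card_sameCycle (n := 4) fun k hk hpos => by
        rcases (Nat.le_of_lt_succ hk).lt_or_eq with hk | rfl
        · exact hne k hk hpos
        · exact gap_eq_one_iff.1 hd
    rw [hd]
    linarith

theorem sum_degree_sub_six_add_sum_gap_le (h : ∀ v, 2 ≤ G.degree v)
    (heuler : G.edgeFinset.card + 1 ≤ Fintype.card V + Nat.card ρ.Face) :
    ∑ v, ((G.degree v : ℚ) - 6) + (∑ d, ρ.gap d) / 2 ≤ -6 := by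
  classical
  have hfaces : Nat.card ρ.Face * 6 ≤ ∑ d : G.Dart, (2 - ρ.gap d / 2) := by
    rw [← Finset.sum_fiberwise Finset.univ (Quotient.mk _ : G.Dart → ρ.Face),
      Nat.card_eq_fintype_card, ← nsmul_eq_mul]
    exact Finset.card_nsmul_le_sum Finset.univ _ 6 fun q _ => ρ.six_le_sum_face h q
  have hdarts : (Fintype.card G.Dart : ℚ) = 2 * G.edgeFinset.card := by
    exact_mod_cast G.dart_card_eq_twice_card_edges
  have hdegrees : ∑ v, (G.degree v : ℚ) = 2 * G.edgeFinset.card := by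
    exact_mod_cast G.sum_degrees_eq_twice_card_edges
  have heuler' : (G.edgeFinset.card : ℚ) + 1 ≤ Fintype.card V + Nat.card ρ.Face := by
    exact_mod_cast heuler
  rw [Finset.sum_sub_distrib, ← Finset.sum_div, Finset.sum_const, Finset.card_univ,
    nsmul_eq_mul, hdarts] at hfaces
  rw [Finset.sum_sub_distrib, hdegrees, Finset.sum_const, Finset.card_univ, nsmul_eq_mul]
  linarith

end RotationSystem

/-- The indicator of the darts that end at a vertex with `6 ≤ D`. -/
def largeEnd {V : Type*} {G : SimpleGraph V} (D : V → ℕ) (d : G.Dart) : ℚ :=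
  if 6 ≤ D d.snd then 1 else 0

section LargeEnd

variable {V : Type*} {G : SimpleGraph V} {D : V → ℕ} {d : G.Dart}

theorem largeEnd_of_six_le (hd : 6 ≤ D d.snd) : largeEnd D d = 1 := if_pos hd

theorem largeEnd_of_lt_six (hd : D d.snd < 6) : largeEnd D d = 0 := if_neg hd.not_ge

theorem largeEnd_nonneg : 0 ≤ largeEnd D d := by
  rw [largeEnd]
  split_ifs <;> norm_num

theorem largeEnd_le_one : largeEnd D d ≤ 1 := by
  rw [largeEnd]
  split_ifs <;> norm_num

theorem six_le_of_largeEnd_pos (hd : 0 < largeEnd D d) : 6 ≤ D d.snd := by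
  by_contra hlt
  exact hd.ne' (largeEnd_of_lt_six (not_le.1 hlt))

end LargeEnd

namespace RotationSystem

variable {V : Type*} {G : SimpleGraph V} (ρ : RotationSystem G) (D : V → ℕ)

open Classical in
/-- The charge that `d.fst` sends to `d.snd` when `D` is used for the degrees. -/
noncomputable def transfer (d : G.Dart) : ℚ :=
  if D d.snd = 3 then 1 - ρ.sides d / 4
  else if D d.snd = 4 then
    if 8 ≤ D d.fst then (if ∃ w, G.Adj d.snd w ∧ D w ≤ 7 then 2 / 3 else 1 / 2) else 0
  else if D d.snd = 5 then
    if 8 ≤ D d.fst then (if ∀ w, G.Adj d.snd w → 6 ≤ D w then 1 / 2 else 1 / 3)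
    else if D d.fst = 7 then 1 / 4 else 0
  else 0

/-- The net charge that `d.fst` spends on `d.snd`: the non-triangular faces at the edge have a
surplus, of which each of its ends receives `1 / 4` per side. -/
noncomputable def cost (d : G.Dart) : ℚ := ρ.transfer D d - ρ.sides d / 4

/-- The number of the two darts next to `d` in the rotation that end at a vertex with `6 ≤ D`. -/
def largeFlanks (d : G.Dart) : ℚ := largeEnd D (ρ.rot d) + largeEnd D (ρ.rot⁻¹ d)

variable {D} {d : G.Dart}

theorem transfer_nonneg : 0 ≤ ρ.transfer D d := by
  have := ρ.sides_le_two d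
  rw [transfer]
  split_ifs <;> linarith

theorem transfer_le_one : ρ.transfer D d ≤ 1 := by
  have := ρ.sides_nonneg d
  rw [transfer]
  split_ifs <;> linarith

theorem transfer_of_six_le (hd : 6 ≤ D d.snd) : ρ.transfer D d = 0 := by
  rw [transfer, if_neg (by omega), if_neg (by omega), if_neg (by omega)]

theorem transfer_of_three (hd : D d.snd = 3) : ρ.transfer D d = 1 - ρ.sides d / 4 := by
  rw [transfer, if_pos hd]

open Classical in
theorem transfer_of_four (hd : D d.snd = 4) (hv : 8 ≤ D d.fst) : ρ.transfer D d =
    if ∃ w, G.Adj d.snd w ∧ D w ≤ 7 then 2 / 3 else 1 / 2 := by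
  rw [transfer, if_neg (by omega), if_pos hd, if_pos hv]

theorem transfer_le_of_four (hd : D d.snd = 4) (hv : 8 ≤ D d.fst) : ρ.transfer D d ≤ 2 / 3 := by
  rw [ρ.transfer_of_four hd hv]
  split_ifs <;> norm_num

open Classical in
theorem transfer_of_five (hd : D d.snd = 5) (hv : 8 ≤ D d.fst) : ρ.transfer D d =
    if ∀ w, G.Adj d.snd w → 6 ≤ D w then 1 / 2 else 1 / 3 := by
  rw [transfer, if_neg (by omega), if_neg (by omega), if_pos hd, if_pos hv]

theorem transfer_of_seven (hd : D d.snd ≠ 3) (hv : D d.fst = 7) :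
    ρ.transfer D d = if D d.snd = 5 then 1 / 4 else 0 := by
  rw [transfer, if_neg hd, if_neg (by omega : ¬ 8 ≤ D d.fst), if_neg (by omega : ¬ 8 ≤ D d.fst),
    if_pos hv]
  split_ifs <;> first | rfl | omega

theorem transfer_of_le_six (hd : D d.snd ≠ 3) (hv : D d.fst ≤ 6) : ρ.transfer D d = 0 := by
  rw [transfer, if_neg hd]
  split_ifs <;> first | rfl | omega

theorem cost_le_transfer : ρ.cost D d ≤ ρ.transfer D d := by
  have := ρ.sides_nonneg d
  rw [cost]
  linarith

theorem cost_le_one : ρ.cost D d ≤ 1 := ρ.cost_le_transfer.trans ρ.transfer_le_one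

theorem cost_nonpos (hd : 6 ≤ D d.snd) : ρ.cost D d ≤ 0 :=
  ρ.cost_le_transfer.trans_eq (ρ.transfer_of_six_le hd)

theorem cost_of_three (hd : D d.snd = 3) : ρ.cost D d = 1 - ρ.sides d / 2 := by
  rw [cost, ρ.transfer_of_three hd]
  ring

theorem largeFlanks_nonneg : 0 ≤ ρ.largeFlanks D d := add_nonneg largeEnd_nonneg largeEnd_nonneg

theorem largeFlanks_le_two : ρ.largeFlanks D d ≤ 2 :=
  (add_le_add largeEnd_le_one largeEnd_le_one).trans_eq one_add_one_eq_two

theorem two_sub_sides_le_largeFlanks (hlarge : ∀ w, G.Adj d.snd w → w ≠ d.fst → 6 ≤ D w) :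
    2 - ρ.sides d ≤ ρ.largeFlanks D d := by
  have hrot : 1 - ρ.gap d ≤ largeEnd D (ρ.rot d) := by
    rcases ρ.gap_eq_one_or_adj d with hgap | ⟨hgap, hadj⟩
    · rw [hgap, sub_self]
      exact largeEnd_nonneg
    · rw [hgap, largeEnd_of_six_le (hlarge _ hadj (ρ.rot_fst d ▸ (ρ.rot d).adj.ne')), sub_zero]
  have hrot_inv : 1 - ρ.gap d.symm ≤ largeEnd D (ρ.rot⁻¹ d) := by
    rcases ρ.gap_symm_eq_one_or_adj d with hgap | ⟨hgap, hadj⟩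
    · rw [hgap, sub_self]
      exact largeEnd_nonneg
    · rw [hgap, largeEnd_of_six_le (hlarge _ hadj (ρ.rot_inv_fst d ▸ (ρ.rot⁻¹ d).adj.ne')),
        sub_zero]
  rw [sides, largeFlanks]
  linarith

theorem cost_le_of_large_nbrs {a : ℚ} (ha : ρ.transfer D d ≤ a)
    (hlarge : ∀ w, G.Adj d.snd w → w ≠ d.fst → 6 ≤ D w) :
    ρ.cost D d ≤ a - 1 / 2 + ρ.largeFlanks D d / 4 := by
  have := ρ.two_sub_sides_le_largeFlanks hlarge
  rw [cost]
  linarith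

theorem transfer_le_or_cost_le_of_five (hd : D d.snd = 5) (hv : 8 ≤ D d.fst) :
    ρ.transfer D d ≤ 1 / 3 ∨ ρ.cost D d ≤ ρ.largeFlanks D d / 4 := by
  have htransfer := ρ.transfer_of_five hd hv
  by_cases hlarge : ∀ w, G.Adj d.snd w → 6 ≤ D w
  · rw [if_pos hlarge] at htransfer
    right
    linarith [ρ.cost_le_of_large_nbrs htransfer.le fun w hw _ => hlarge w hw]
  · rw [if_neg hlarge] at htransfer
    exact Or.inl htransfer.le

variable [Fintype V] [DecidableRel G.Adj]

theorem rot_snd_ne_rot_inv_snd (hdeg : 3 ≤ G.degree d.fst) : (ρ.rot d).snd ≠ (ρ.rot⁻¹ d).snd :=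
  fun hsnd => ρ.rot_ne_rot_inv hdeg (eq_of_mem_dartsAt (ρ.rot_mem_dartsAt (mem_dartsAt_fst d))
    (ρ.rot_inv_mem_dartsAt (mem_dartsAt_fst d)) hsnd)

theorem cost_le_of_one_small_nbr (hdeg : 3 ≤ G.degree d.fst) {a : ℚ} (ha : ρ.transfer D d ≤ a)
    (hlarge : ∀ w x, G.Adj d.snd w → G.Adj d.snd x → w ≠ x → w ≠ d.fst → x ≠ d.fst →
      6 ≤ D w ∨ 6 ≤ D x) :
    ρ.cost D d ≤ a - 1 / 4 + ρ.largeFlanks D d / 4 := by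
  suffices h : 1 ≤ ρ.sides d + ρ.largeFlanks D d by
    rw [cost]
    linarith
  have hflanks := ρ.largeFlanks_nonneg (D := D) (d := d)
  have hgap := ρ.gap_nonneg d
  have hgap_symm := ρ.gap_nonneg d.symm
  rw [sides]
  rcases ρ.gap_eq_one_or_adj d with hone | ⟨-, hadj⟩
  · linarith
  rcases ρ.gap_symm_eq_one_or_adj d with hone | ⟨-, hadj'⟩
  · linarith
  have hrot : 0 ≤ largeEnd D (ρ.rot d) := largeEnd_nonneg
  have hrot_inv : 0 ≤ largeEnd D (ρ.rot⁻¹ d) := largeEnd_nonneg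
  rw [largeFlanks]
  rcases hlarge _ _ hadj hadj' (ρ.rot_snd_ne_rot_inv_snd hdeg)
    (ρ.rot_fst d ▸ (ρ.rot d).adj.ne') (ρ.rot_inv_fst d ▸ (ρ.rot⁻¹ d).adj.ne') with h6 | h6
  all_goals
    rw [largeEnd_of_six_le h6]
    linarith

theorem sum_cost_le_of_local {v : V} {b : ℚ} (hb : 0 ≤ b) (hlocal : ∀ d ∈ dartsAt G v,
    D d.snd ≤ 5 → ρ.cost D d ≤ b + b / 2 * ρ.largeFlanks D d) :
    ∑ d ∈ dartsAt G v, ρ.cost D d ≤ b * G.degree v := by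
  refine ρ.sum_le_of_local (χ := largeEnd D) fun d hd => ?_
  rw [← largeFlanks]
  rcases le_or_gt 6 (D d.snd) with h6 | h6
  · have hcost := ρ.cost_nonpos h6
    have hflanks := mul_nonneg (div_nonneg hb zero_le_two) (ρ.largeFlanks_nonneg (D := D) (d := d))
    rw [largeEnd_of_six_le h6]
    linarith
  · rw [largeEnd_of_lt_six h6, mul_zero, sub_zero]
    exact hlocal d hd (Nat.le_of_lt_succ h6)

theorem sum_cost_le_card (v : V) : ∑ d ∈ dartsAt G v, ρ.cost D d ≤
    ((G.neighborFinset v).filter fun w => D w ≤ 5).card := by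
  rw [← card_filter_dartsAt, Finset.card_filter, Nat.cast_sum]
  refine Finset.sum_le_sum fun d _ => ?_
  split_ifs with h5
  · exact_mod_cast ρ.cost_le_one
  · exact_mod_cast ρ.cost_nonpos (not_le.1 h5)

end RotationSystem

/-- The local conditions that make the discharging argument work. Here `D v` stands for the degree
of `v` in an ambient graph, in which `v` may have further neighbours if its degree is large. -/
structure ConfigFree {V : Type*} [Fintype V] (G : SimpleGraph V) [DecidableRel G.Adj]
    (D : V → ℕ) : Prop where
  three_le : ∀ v, 3 ≤ G.degree v
  degree_eq : ∀ v, G.degree v = D v ∨ 9 ≤ D v ∧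
    ((G.neighborFinset v).filter fun w => D w ≤ 8).card + 8 ≤ G.degree v
  three_adj : ∀ u v, D u = 3 → G.Adj u v → 9 ≤ D v
  three_nine : ∀ u v w, D u = 3 → D v = 9 → G.Adj u v → G.Adj u w → ¬ G.Adj v w
  three_ten : ∀ u v w x, D u = 3 → D v = 10 → G.Adj u v → w ≠ x → G.Adj u w → G.Adj v w →
    G.Adj u x → G.Adj v x → ((G.neighborFinset v).filter fun w => D w ≤ 5).card ≤ 4
  four : ∀ v u w, D v = 4 → G.Adj v u → G.Adj v w → u ≠ w → D u ≤ 7 → 18 ≤ D u + D w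
  five : ∀ v x y z, D v = 5 → G.Adj v x → G.Adj v y → G.Adj v z → x ≠ y → x ≠ z → y ≠ z →
    19 ≤ D x + D y + D z
  five_six_seven : ∀ v, D v = 5 → (∀ w, G.Adj v w → D w = 6 ∨ D w = 7) →
    ((G.neighborFinset v).filter fun w => D w = 6).card = 2 →
    ∀ x y, G.Adj v x → G.Adj v y → D x = 6 → D y = 7 → ¬ G.Adj x y

namespace ConfigFree

variable {V : Type*} [Fintype V] {G : SimpleGraph V} [DecidableRel G.Adj] {D : V → ℕ}
  (h : ConfigFree G D) (ρ : RotationSystem G) {v : V} {d : G.Dart}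

include h

theorem three_le_apply (v : V) : 3 ≤ D v := by
  have := h.three_le v
  rcases h.degree_eq v with hv | hv <;> omega

theorem degree_eq_of_le (hv : D v ≤ 8) : G.degree v = D v :=
  (h.degree_eq v).resolve_right fun h' => by omega

theorem three_or_four_or_five (hv : D v ≤ 5) : D v = 3 ∨ D v = 4 ∨ D v = 5 := by
  have := h.three_le_apply v
  omega

theorem transfer_of_le_six (hv : D d.fst ≤ 6) : ρ.transfer D d = 0 :=
  ρ.transfer_of_le_six (fun h3 => by have := h.three_adj _ _ h3 d.adj.symm; omega) hv

theorem cost_le_of_three (h3 : D d.snd = 3) : ρ.cost D d ≤ ρ.largeFlanks D d / 2 := by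
  have hsides := ρ.two_sub_sides_le_largeFlanks (D := D) (d := d) fun w hw _ => by
    have := h.three_adj _ _ h3 hw
    omega
  rw [ρ.cost_of_three h3]
  linarith

theorem cost_le_of_four (h4 : D d.snd = 4) (hv : 8 ≤ D d.fst) (hv' : D d.fst ≤ 10) :
    ρ.cost D d ≤ ρ.largeFlanks D d / 4 := by
  have hlarge : ∀ w, G.Adj d.snd w → 8 ≤ D w := fun w hw => by
    by_contra hsmall
    have hne : w ≠ d.fst := by
      rintro rfl
      exact hsmall hv
    have := h.four d.snd w d.fst h4 hw d.adj.symm hne (by omega)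
    omega
  have htransfer := ρ.transfer_of_four h4 hv
  rw [if_neg fun ⟨w, hw, hw7⟩ => by have := hlarge w hw; omega] at htransfer
  have := ρ.cost_le_of_large_nbrs htransfer.le fun w hw _ => le_trans (by norm_num) (hlarge w hw)
  linarith

theorem sum_cost_le_of_eight (hv : D v = 8) : ∑ d ∈ dartsAt G v, ρ.cost D d ≤ 2 := by
  refine (ρ.sum_cost_le_of_local (b := 1 / 4) (by norm_num) fun d hd hs => ?_).trans_eq ?_
  · obtain rfl := mem_dartsAt.1 hd
    have hflanks' := ρ.largeFlanks_le_two (D := D) (d := d)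
    rcases h.three_or_four_or_five hs with h3 | h4 | h5
    · have := h.three_adj _ _ h3 d.adj.symm
      omega
    · linarith [h.cost_le_of_four ρ h4 hv.ge (by omega)]
    · rcases ρ.transfer_le_or_cost_le_of_five h5 hv.ge with htransfer | hcost
      · have hcost := ρ.cost_le_of_one_small_nbr (h.three_le _) htransfer
          fun w x hw hx hwx hwv hxv => by
            have := h.five d.snd w x d.fst h5 hw hx d.adj.symm hwx hwv hxv
            omega
        linarith [ρ.cost_le_transfer (D := D) (d := d)]
      · linarith
  · rw [h.degree_eq_of_le hv.le, hv]
    norm_num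

theorem sum_cost_le_of_nine (hdeg : G.degree v = D v) (hv : D v = 9) :
    ∑ d ∈ dartsAt G v, ρ.cost D d ≤ 3 := by
  refine (ρ.sum_cost_le_of_local (b := 1 / 3) (by norm_num) fun d hd hs => ?_).trans_eq ?_
  · obtain rfl := mem_dartsAt.1 hd
    have hflanks := ρ.largeFlanks_nonneg (D := D) (d := d)
    have hflanks' := ρ.largeFlanks_le_two (D := D) (d := d)
    rcases h.three_or_four_or_five hs with h3 | h4 | h5
    · have hgap := (ρ.gap_eq_one_or_adj d).resolve_right fun hadj =>
        h.three_nine _ _ _ h3 hv d.adj.symm hadj.2 (adj_of_mem_dartsAt (ρ.rot_mem_dartsAt hd))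
      have hgap_symm := (ρ.gap_symm_eq_one_or_adj d).resolve_right fun hadj =>
        h.three_nine _ _ _ h3 hv d.adj.symm hadj.2
          (adj_of_mem_dartsAt (ρ.rot_inv_mem_dartsAt hd))
      rw [ρ.cost_of_three h3, RotationSystem.sides, hgap, hgap_symm]
      linarith
    · linarith [h.cost_le_of_four ρ h4 (by omega) (by omega)]
    · rcases ρ.transfer_le_or_cost_le_of_five h5 (by omega) with htransfer | hcost
      · linarith [ρ.cost_le_transfer (D := D) (d := d)]
      · linarith
  · rw [hdeg, hv]
    norm_num

theorem cost_le_half_of_three (h3 : D d.snd = 3) (hv : D d.fst = 10)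
    (hcard : ¬ ((G.neighborFinset d.fst).filter fun w => D w ≤ 5).card ≤ 4) :
    ρ.cost D d ≤ 1 / 2 := by
  suffices hsides : 1 ≤ ρ.sides d by
    rw [ρ.cost_of_three h3]
    linarith
  have hgap := ρ.gap_nonneg d
  have hgap_symm := ρ.gap_nonneg d.symm
  rw [RotationSystem.sides]
  rcases ρ.gap_eq_one_or_adj d with hone | ⟨-, hadj⟩
  · linarith
  rcases ρ.gap_symm_eq_one_or_adj d with hone | ⟨-, hadj'⟩
  · linarith
  have hd := mem_dartsAt_fst d
  exact absurd (h.three_ten _ _ _ _ h3 hv d.adj.symm (ρ.rot_snd_ne_rot_inv_snd (h.three_le _)) hadj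
    (adj_of_mem_dartsAt (ρ.rot_mem_dartsAt hd)) hadj'
    (adj_of_mem_dartsAt (ρ.rot_inv_mem_dartsAt hd))) hcard

theorem sum_cost_le_of_ten (hdeg : G.degree v = D v) (hv : D v = 10) :
    ∑ d ∈ dartsAt G v, ρ.cost D d ≤ 4 := by
  by_cases hcard : ((G.neighborFinset v).filter fun w => D w ≤ 5).card ≤ 4
  · exact (ρ.sum_cost_le_card v).trans (by exact_mod_cast hcard)
  refine (ρ.sum_cost_le_of_local (b := 2 / 5) (by norm_num) fun d hd hs => ?_).trans_eq ?_
  · obtain rfl := mem_dartsAt.1 hd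
    have hflanks := ρ.largeFlanks_nonneg (D := D) (d := d)
    have hflanks' := ρ.largeFlanks_le_two (D := D) (d := d)
    rcases h.three_or_four_or_five hs with h3 | h4 | h5
    · linarith [h.cost_le_half_of_three ρ h3 hv hcard, h.cost_le_of_three ρ h3]
    · linarith [h.cost_le_of_four ρ h4 (by omega) (by omega)]
    · rcases ρ.transfer_le_or_cost_le_of_five h5 (by omega) with htransfer | hcost
      · linarith [ρ.cost_le_transfer (D := D) (d := d)]
      · linarith
  · rw [hdeg, hv]
    norm_num

theorem sum_cost_le_of_twelve_le (hdeg : G.degree v = D v) (hv : 12 ≤ D v) :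
    ∑ d ∈ dartsAt G v, ρ.cost D d ≤ (D v : ℚ) - 6 := by
  refine (ρ.sum_cost_le_of_local (b := 1 / 2) (by norm_num) fun d hd hs => ?_).trans ?_
  · obtain rfl := mem_dartsAt.1 hd
    have hflanks := ρ.largeFlanks_nonneg (D := D) (d := d)
    have hflanks' := ρ.largeFlanks_le_two (D := D) (d := d)
    rcases h.three_or_four_or_five hs with h3 | h4 | h5
    · linarith [h.cost_le_of_three ρ h3]
    · have hcost := ρ.cost_le_of_one_small_nbr (h.three_le _)
        (ρ.transfer_le_of_four h4 (by omega)) fun w x hw hx hwx _ _ => by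
          by_contra hsmall
          have := h.four d.snd w x h4 hw hx hwx (by omega)
          omega
      linarith
    · rcases ρ.transfer_le_or_cost_le_of_five h5 (by omega) with htransfer | hcost
      · linarith [ρ.cost_le_transfer (D := D) (d := d)]
      · linarith
  · have : (12 : ℚ) ≤ D v := by exact_mod_cast hv
    rw [hdeg]
    linarith

theorem cost_le_third_or_of_eleven (hs : D d.snd ≤ 5) (hv : D d.fst = 11) :
    ρ.cost D d ≤ 1 / 3 ∨ ρ.cost D d ≤ ρ.largeFlanks D d / 2 := by
  have hflanks := ρ.largeFlanks_nonneg (D := D) (d := d)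
  rcases h.three_or_four_or_five hs with h3 | h4 | h5
  · exact Or.inr (h.cost_le_of_three ρ h3)
  · have hcost := ρ.cost_le_of_large_nbrs (ρ.transfer_le_of_four h4 (by omega))
      fun w hw hne => by
        by_contra hsmall
        have := h.four d.snd w d.fst h4 hw d.adj.symm hne (by omega)
        omega
    rcases le_total (ρ.largeFlanks D d) (2 / 3) with hle | hle
    · left
      linarith
    · right
      linarith
  · rcases ρ.transfer_le_or_cost_le_of_five h5 (by omega) with htransfer | hcost
    · exact Or.inl (ρ.cost_le_transfer.trans htransfer)
    · right
      linarith

theorem flanks_large_of_half_lt_cost (hv : D d.fst = 11) (hcost : 1 / 2 < ρ.cost D d) :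
    6 ≤ D (ρ.rot d).snd ∧ 6 ≤ D (ρ.rot⁻¹ d).snd := by
  have hs : D d.snd ≤ 5 := by
    by_contra h6
    linarith [ρ.cost_nonpos (D := D) (d := d) (by omega)]
  have hflanks := (h.cost_le_third_or_of_eleven ρ hs hv).resolve_left (by linarith)
  have hrot : largeEnd D (ρ.rot d) ≤ 1 := largeEnd_le_one
  have hrot_inv : largeEnd D (ρ.rot⁻¹ d) ≤ 1 := largeEnd_le_one
  rw [RotationSystem.largeFlanks] at hflanks
  exact ⟨six_le_of_largeEnd_pos (by linarith), six_le_of_largeEnd_pos (by linarith)⟩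

theorem sum_cost_le_of_eleven_of_lt_six (hdeg : G.degree v = D v) (hv : D v = 11)
    (hsmall : ∀ d ∈ dartsAt G v, D d.snd < 6) : ∑ d ∈ dartsAt G v, ρ.cost D d ≤ 5 := by
  have hthird : ∀ d ∈ dartsAt G v, ρ.cost D d ≤ 1 / 3 := fun d hd => by
    rcases h.cost_le_third_or_of_eleven ρ (Nat.le_of_lt_succ (hsmall d hd))
      ((mem_dartsAt.1 hd).symm ▸ hv) with hcost | hcost
    · exact hcost
    · rw [RotationSystem.largeFlanks, largeEnd_of_lt_six (hsmall _ (ρ.rot_mem_dartsAt hd)),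
        largeEnd_of_lt_six (hsmall _ (ρ.rot_inv_mem_dartsAt hd))] at hcost
      linarith
  refine (Finset.sum_le_card_nsmul _ _ _ hthird).trans ?_
  rw [card_dartsAt, hdeg, hv]
  norm_num

-- Expensive neighbours, those with cost above `1 / 2`, have large ones on both sides. As 11 is
-- odd, there are more large neighbours than expensive ones, unless there are none of either kind.
theorem sum_cost_le_of_eleven (hdeg : G.degree v = D v) (hv : D v = 11) :
    ∑ d ∈ dartsAt G v, ρ.cost D d ≤ 5 := by
  have hcard : (dartsAt G v).card = 11 := by rw [card_dartsAt, hdeg, hv]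
  set large := (dartsAt G v).filter fun d => 6 ≤ D d.snd with hlarge
  set costly := (dartsAt G v).filter fun d => 1 / 2 < ρ.cost D d with hcostly
  have hflanks : ∀ d ∈ costly, ρ.rot d ∈ large ∧ ρ.rot⁻¹ d ∈ large := fun d hd => by
    obtain ⟨hd, hcost⟩ := Finset.mem_filter.1 hd
    obtain ⟨hrot, hrot_inv⟩ :=
      h.flanks_large_of_half_lt_cost ρ ((mem_dartsAt.1 hd).symm ▸ hv) hcost
    exact ⟨Finset.mem_filter.2 ⟨ρ.rot_mem_dartsAt hd, hrot⟩,
      Finset.mem_filter.2 ⟨ρ.rot_inv_mem_dartsAt hd, hrot_inv⟩⟩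
  have hdisjoint : Disjoint costly large := Finset.disjoint_left.2 fun d hd hd' => by
    linarith [(Finset.mem_filter.1 hd).2, ρ.cost_nonpos (Finset.mem_filter.1 hd').2]
  rcases large.eq_empty_or_nonempty with hempty | hnonempty
  · exact h.sum_cost_le_of_eleven_of_lt_six ρ hdeg hv fun d hd =>
      not_le.1 (Finset.filter_eq_empty_iff.1 hempty hd)
  · have hlt : (costly.card : ℚ) + 1 ≤ large.card := by
      exact_mod_cast ρ.card_lt_card_of_odd (by rw [hdeg, hv]; decide) hnonempty
        (Finset.filter_subset _ _) hdisjoint hflanks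
    have hbound : ∀ d ∈ dartsAt G v, ρ.cost D d ≤ 1 / 2 +
        (if 1 / 2 < ρ.cost D d then 1 / 2 else 0) - if 6 ≤ D d.snd then 1 / 2 else 0 :=
      fun d _ => by
        have hone := ρ.cost_le_one (D := D) (d := d)
        have hzero := ρ.cost_nonpos (D := D) (d := d)
        split_ifs with hcost h6 h6 <;> first | linarith [hzero h6] | linarith
    refine (Finset.sum_le_sum hbound).trans ?_
    rw [Finset.sum_sub_distrib, Finset.sum_add_distrib, Finset.sum_const, hcard,
      ← Finset.sum_filter, ← Finset.sum_filter, Finset.sum_const, Finset.sum_const, ← hlarge,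
      ← hcostly, nsmul_eq_mul, nsmul_eq_mul, nsmul_eq_mul]
    push_cast
    linarith

end ConfigFree

theorem RotationSystem.sum_gap_eq_card {V : Type*} {G : SimpleGraph V} (ρ : RotationSystem G)
    (s : Finset G.Dart) : ∑ d ∈ s, ρ.gap d = (s.filter fun d => ρ.gap d = 1).card := by
  rw [Finset.card_filter, Nat.cast_sum]
  refine Finset.sum_congr rfl fun d _ => ?_
  rcases ρ.gap_eq_zero_or_one d with hgap | hgap <;> simp [hgap]

theorem RotationSystem.sum_cost {V : Type*} {G : SimpleGraph V} [Fintype V] [DecidableRel G.Adj]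
    (ρ : RotationSystem G) (D : V → ℕ) (v : V) : ∑ d ∈ dartsAt G v, ρ.cost D d =
      ∑ d ∈ dartsAt G v, ρ.transfer D d - (∑ d ∈ dartsAt G v, ρ.gap d) / 2 := by
  simp only [RotationSystem.cost]
  rw [Finset.sum_sub_distrib, ← Finset.sum_div, ρ.sum_sides_dartsAt]
  ring

namespace ConfigFree

variable {V : Type*} [Fintype V] {G : SimpleGraph V} [DecidableRel G.Adj] {D : V → ℕ}
  (h : ConfigFree G D) (ρ : RotationSystem G) {v : V} {d : G.Dart}

include h

theorem window_le (hv : D d.fst = 7) :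
    (if D d.snd = 5 then 1 else 0) + (if D (ρ.rot d).snd = 5 then 1 else 0) +
      (if D (ρ.rot (ρ.rot d)).snd = 5 then 1 else 0) ≤ 2 + (ρ.gap d + ρ.gap (ρ.rot d)) := by
  have hgap := ρ.gap_nonneg d
  have hgap' := ρ.gap_nonneg (ρ.rot d)
  rcases ρ.gap_eq_one_or_adj d with hone | ⟨-, hadj⟩
  · split_ifs <;> linarith
  rcases ρ.gap_eq_one_or_adj (ρ.rot d) with hone | ⟨-, hadj'⟩
  · split_ifs <;> linarith
  split_ifs with h5 h5' h5''
  · have hd := mem_dartsAt_fst d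
    have hd' := ρ.rot_mem_dartsAt hd
    have hd'' := ρ.rot_mem_dartsAt hd'
    have hne := ρ.rot_snd_ne_rot_inv_snd (h.three_le (ρ.rot d).fst)
    rw [ρ.rot_inv_rot] at hne
    have := h.five _ _ _ _ h5' hadj.symm hadj' (adj_of_mem_dartsAt hd').symm hne.symm
      (adj_of_mem_dartsAt hd).ne' (adj_of_mem_dartsAt hd'').ne'
    omega
  all_goals linarith

theorem three_mul_card_five_le (hv : D v = 7) :
    3 * (((dartsAt G v).filter fun d => D d.snd = 5).card : ℚ) ≤
      14 + 2 * ∑ d ∈ dartsAt G v, ρ.gap d := by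
  have hdeg : G.degree v = 7 := (h.degree_eq_of_le (by omega)).trans hv
  have hsum := Finset.sum_le_sum fun d (hd : d ∈ dartsAt G v) =>
    h.window_le ρ (d := d) ((mem_dartsAt.1 hd).symm ▸ hv)
  simp only [Finset.sum_add_distrib] at hsum
  rw [ρ.sum_rot v fun d => if D (ρ.rot d).snd = 5 then (1 : ℚ) else 0,
    ρ.sum_rot v fun d => if D d.snd = 5 then (1 : ℚ) else 0, ρ.sum_rot v ρ.gap, Finset.sum_boole,
    Finset.sum_const, card_dartsAt, hdeg] at hsum
  norm_num at hsum
  linarith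

theorem sum_cost_le_of_seven (hv : D v = 7) : ∑ d ∈ dartsAt G v, ρ.cost D d ≤ 1 := by
  have htransfer : ∀ d ∈ dartsAt G v, ρ.transfer D d = if D d.snd = 5 then 1 / 4 else 0 :=
    fun d hd => by
      obtain rfl := mem_dartsAt.1 hd
      exact ρ.transfer_of_seven (fun h3 => by have := h.three_adj _ _ h3 d.adj.symm; omega) hv
  have hwindow := h.three_mul_card_five_le ρ hv
  rw [ρ.sum_cost, Finset.sum_congr rfl htransfer, ← Finset.sum_filter, Finset.sum_const,
    nsmul_eq_mul]
  rw [ρ.sum_gap_eq_card] at hwindow ⊢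
  set fives := ((dartsAt G v).filter fun d => D d.snd = 5).card
  set gaps := ((dartsAt G v).filter fun d => ρ.gap d = 1).card
  -- The factor of `gaps` is not the optimal one: the constant term is what rounding improves.
  have hround : fives ≤ 4 + 2 * gaps := by
    have : 3 * fives ≤ 14 + 2 * gaps := by exact_mod_cast hwindow
    omega
  have hround' : (fives : ℚ) ≤ 4 + 2 * gaps := by exact_mod_cast hround
  linarith

theorem two_le_sum_transfer_symm (hv : D v = 4) :
    2 ≤ ∑ d ∈ dartsAt G v, ρ.transfer D d.symm := by
  classical
  have hcard : (dartsAt G v).card = 4 := by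
    rw [card_dartsAt, h.degree_eq_of_le (by omega), hv]
  by_cases hsmall : ∃ w, G.Adj v w ∧ D w ≤ 7
  · obtain ⟨w, hw, hw7⟩ := hsmall
    have hmem : (⟨(v, w), hw⟩ : G.Dart) ∈ dartsAt G v := mem_dartsAt.2 rfl
    have hthird : ∀ d ∈ (dartsAt G v).erase ⟨(v, w), hw⟩, 2 / 3 ≤ ρ.transfer D d.symm :=
      fun d hd => by
        obtain ⟨hne, hd⟩ := Finset.mem_erase.1 hd
        have h18 := h.four v w d.snd hv hw (adj_of_mem_dartsAt hd)
          (fun hsnd => hne (eq_of_mem_dartsAt hd hmem hsnd.symm)) hw7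
        obtain rfl := mem_dartsAt.1 hd
        rw [ρ.transfer_of_four (d := d.symm) hv (by change 8 ≤ D d.snd; omega),
          if_pos ⟨w, hw, hw7⟩]
    have hsum := Finset.card_nsmul_le_sum _ _ _ hthird
    rw [Finset.card_erase_of_mem hmem, hcard] at hsum
    refine le_trans (by norm_num) (hsum.trans ?_)
    exact Finset.sum_le_sum_of_subset_of_nonneg (Finset.erase_subset _ _)
      fun d _ _ => ρ.transfer_nonneg
  · have hhalf : ∀ d ∈ dartsAt G v, 1 / 2 ≤ ρ.transfer D d.symm := fun d hd => by
      have h8 : ¬ D d.snd ≤ 7 := fun h7 => hsmall ⟨d.snd, adj_of_mem_dartsAt hd, h7⟩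
      obtain rfl := mem_dartsAt.1 hd
      rw [ρ.transfer_of_four (d := d.symm) hv (by change 8 ≤ D d.snd; omega)]
      split_ifs <;> norm_num
    refine le_trans ?_ (Finset.card_nsmul_le_sum _ _ _ hhalf)
    rw [hcard]
    norm_num

theorem card_le_six_le_two (hv : D v = 5) :
    ((dartsAt G v).filter fun d => D d.snd ≤ 6).card ≤ 2 := by
  by_contra hlt
  obtain ⟨a, ha, b, hb, c, hc, hab, hac, hbc⟩ := Finset.two_lt_card.1 (not_le.1 hlt)
  obtain ⟨ha, ha6⟩ := Finset.mem_filter.1 ha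
  obtain ⟨hb, hb6⟩ := Finset.mem_filter.1 hb
  obtain ⟨hc, hc6⟩ := Finset.mem_filter.1 hc
  have := h.five v a.snd b.snd c.snd hv (adj_of_mem_dartsAt ha) (adj_of_mem_dartsAt hb)
    (adj_of_mem_dartsAt hc) (mt (eq_of_mem_dartsAt ha hb) hab) (mt (eq_of_mem_dartsAt ha hc) hac)
    (mt (eq_of_mem_dartsAt hb hc) hbc)
  omega

theorem card_le_six_add_card_seven_le (hv : D v = 5) :
    ((dartsAt G v).filter fun d => D d.snd ≤ 6).card +
      ((dartsAt G v).filter fun d => 7 ≤ D d.snd).card = 5 := by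
  have hsplit := Finset.card_filter_add_card_filter_not (s := dartsAt G v) fun d => D d.snd ≤ 6
  simp only [not_le, Nat.lt_iff_add_one_le] at hsplit
  rw [hsplit, card_dartsAt, h.degree_eq_of_le (by omega), hv]

omit h in
theorem card_seven_le_add_card_eight_le_le_sum (hv : D v = 5) {x : ℚ}
    (hx : ∀ d ∈ dartsAt G v, 8 ≤ D d.snd → x ≤ ρ.transfer D d.symm) :
    ((dartsAt G v).filter fun d => 7 ≤ D d.snd).card * (1 / 4) +
      ((dartsAt G v).filter fun d => 8 ≤ D d.snd).card * (x - 1 / 4) ≤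
        ∑ d ∈ dartsAt G v, ρ.transfer D d.symm := by
  simp only [← nsmul_eq_mul, ← Finset.sum_const, Finset.sum_filter]
  rw [← Finset.sum_add_distrib]
  refine Finset.sum_le_sum fun d hd => ?_
  rcases lt_trichotomy (D d.snd) 7 with h7 | h7 | h7
  · rw [if_neg (by omega), if_neg (by omega), add_zero]
    exact ρ.transfer_nonneg
  · obtain rfl := mem_dartsAt.1 hd
    have htransfer := ρ.transfer_of_seven (d := d.symm) (by change D d.fst ≠ 3; omega) h7
    rw [if_pos (show D d.symm.snd = 5 from hv)] at htransfer
    rw [if_pos h7.ge, if_neg (by omega), add_zero, htransfer]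
  · have h8 : 8 ≤ D d.snd := h7
    rw [if_pos h7.le, if_pos h8, add_sub_cancel]
    exact hx d hd h8

theorem exists_one_le_sides (hv : D v = 5) (h67 : ∀ w, G.Adj v w → D w = 6 ∨ D w = 7)
    (hcard : ((G.neighborFinset v).filter fun w => D w = 6).card = 2) :
    ∃ d ∈ dartsAt G v, 1 ≤ ρ.sides d := by
  by_contra! hsides
  have hrot : ∀ d ∈ dartsAt G v, D d.snd = 6 → D (ρ.rot d).snd = 6 := fun d hd hd6 => by
    have hadj := adj_of_mem_dartsAt (ρ.rot_mem_dartsAt hd)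
    refine (h67 _ hadj).resolve_right fun hd7 => ?_
    rcases ρ.gap_eq_one_or_adj d with hgap | ⟨-, hadj'⟩
    · have hlt := hsides d hd
      rw [RotationSystem.sides, hgap] at hlt
      linarith [ρ.gap_nonneg d.symm]
    · exact h.five_six_seven v hv h67 hcard _ _ (adj_of_mem_dartsAt hd) hadj hd6 hd7 hadj'
  rw [← card_filter_dartsAt v fun w => D w = 6] at hcard
  obtain ⟨d, hd⟩ := Finset.card_pos.1 (hcard ▸ two_pos)
  obtain ⟨hd, hd6⟩ := Finset.mem_filter.1 hd
  rw [Finset.filter_true_of_mem fun e => ρ.rot_induction hrot hd hd6, card_dartsAt,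
    h.degree_eq_of_le (by omega), hv] at hcard
  norm_num at hcard

theorem one_le_sum_of_six_le_nbrs (hv : D v = 5) (h6 : ∀ w, G.Adj v w → 6 ≤ D w) :
    1 ≤ ∑ d ∈ dartsAt G v, (ρ.sides d / 4 + ρ.transfer D d.symm) := by
  have htransfer := card_seven_le_add_card_eight_le_le_sum ρ hv (x := 1 / 2) fun d hd h8 => by
    obtain rfl := mem_dartsAt.1 hd
    rw [ρ.transfer_of_five (d := d.symm) hv h8]
    exact (if_pos h6).ge
  have hsplit := h.card_le_six_add_card_seven_le hv
  have hsix := h.card_le_six_le_two hv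
  set sixes := (dartsAt G v).filter fun d => D d.snd ≤ 6
  set sevens := (dartsAt G v).filter fun d => 7 ≤ D d.snd
  set eights := (dartsAt G v).filter fun d => 8 ≤ D d.snd
  have hsides : ∀ d ∈ dartsAt G v, 0 ≤ ρ.sides d / 4 := fun d _ =>
    div_nonneg (ρ.sides_nonneg d) zero_le_four
  rw [Finset.sum_add_distrib]
  by_cases hcount : 4 ≤ sevens.card + eights.card
  · have hcount' : (4 : ℚ) ≤ sevens.card + eights.card := by exact_mod_cast hcount
    linarith [Finset.sum_nonneg hsides]
  · have h67 : ∀ w, G.Adj v w → D w = 6 ∨ D w = 7 := fun w hw => by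
      have hempty : eights = ∅ := Finset.card_eq_zero.1 (by omega)
      have := h6 w hw
      have := Finset.filter_eq_empty_iff.1 hempty (x := ⟨(v, w), hw⟩) (mem_dartsAt.2 rfl)
      change ¬ 8 ≤ D w at this
      omega
    have hcard : ((G.neighborFinset v).filter fun w => D w = 6).card = 2 := by
      rw [← card_filter_dartsAt, show 2 = sixes.card by omega]
      refine congrArg Finset.card (Finset.filter_congr fun d hd => ?_)
      have := h6 d.snd (adj_of_mem_dartsAt hd)
      omega
    obtain ⟨d, hd, hone⟩ := h.exists_one_le_sides ρ hv h67 hcard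
    have hsingle := Finset.single_le_sum hsides hd
    have hthree : (3 : ℚ) ≤ sevens.card := by exact_mod_cast (by omega : 3 ≤ sevens.card)
    have : (0 : ℚ) ≤ eights.card := Nat.cast_nonneg _
    linarith

theorem one_le_sum_transfer_symm {w : V} (hv : D v = 5) (hw : G.Adj v w) (hw5 : D w ≤ 5) :
    1 ≤ ∑ d ∈ dartsAt G v, ρ.transfer D d.symm := by
  have htransfer := card_seven_le_add_card_eight_le_le_sum ρ hv (x := 1 / 3) fun d hd h8 => by
    obtain rfl := mem_dartsAt.1 hd
    rw [ρ.transfer_of_five (d := d.symm) hv h8]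
    split_ifs <;> norm_num
  have hsplit := h.card_le_six_add_card_seven_le hv
  have hsix := h.card_le_six_le_two hv
  set sixes := (dartsAt G v).filter fun d => D d.snd ≤ 6
  set sevens := (dartsAt G v).filter fun d => 7 ≤ D d.snd
  set eights := (dartsAt G v).filter fun d => 8 ≤ D d.snd
  by_cases hcount : 4 ≤ sevens.card
  · have hcount' : (4 : ℚ) ≤ sevens.card := by exact_mod_cast hcount
    have : (0 : ℚ) ≤ eights.card := Nat.cast_nonneg _
    linarith
  · obtain ⟨a, ha, hne⟩ := Finset.exists_mem_ne (by omega : 1 < sixes.card) ⟨(v, w), hw⟩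
    obtain ⟨ha, ha6⟩ := Finset.mem_filter.1 ha
    have heq : eights = sevens := Finset.filter_congr fun d hd => by
      refine ⟨fun h8 => by omega, fun h7 => ?_⟩
      have := h.five v w a.snd d.snd hv hw (adj_of_mem_dartsAt ha) (adj_of_mem_dartsAt hd)
        (fun hsnd => hne (eq_of_mem_dartsAt ha (mem_dartsAt.2 rfl) hsnd.symm))
        (fun hsnd => by rw [← hsnd] at h7; omega) (fun hsnd => by rw [← hsnd] at h7; omega)
      omega
    have hthree : (3 : ℚ) ≤ sevens.card := by exact_mod_cast (by omega : 3 ≤ sevens.card)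
    rw [heq] at htransfer
    linarith

theorem one_le_sum_of_five (hv : D v = 5) :
    1 ≤ ∑ d ∈ dartsAt G v, (ρ.sides d / 4 + ρ.transfer D d.symm) := by
  by_cases h6 : ∀ w, G.Adj v w → 6 ≤ D w
  · exact h.one_le_sum_of_six_le_nbrs ρ hv h6
  · push Not at h6
    obtain ⟨w, hw, hw6⟩ := h6
    refine (h.one_le_sum_transfer_symm ρ hv hw (Nat.le_of_lt_succ hw6)).trans ?_
    refine Finset.sum_le_sum fun d _ => le_add_of_nonneg_left ?_
    exact div_nonneg (ρ.sides_nonneg d) zero_le_four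

theorem sum_cost_le (hv : 7 ≤ D v) : ∑ d ∈ dartsAt G v, ρ.cost D d ≤ (G.degree v : ℚ) - 6 := by
  rcases h.degree_eq v with hdeg | ⟨-, hcard⟩
  · rw [hdeg]
    rcases (by omega : D v = 7 ∨ D v = 8 ∨ D v = 9 ∨ D v = 10 ∨ D v = 11 ∨ 12 ≤ D v) with
      hv | hv | hv | hv | hv | hv
    · exact (h.sum_cost_le_of_seven ρ hv).trans_eq (by rw [hv]; norm_num)
    · exact (h.sum_cost_le_of_eight ρ hv).trans_eq (by rw [hv]; norm_num)
    · exact (h.sum_cost_le_of_nine ρ hdeg hv).trans_eq (by rw [hv]; norm_num)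
    · exact (h.sum_cost_le_of_ten ρ hdeg hv).trans_eq (by rw [hv]; norm_num)
    · exact (h.sum_cost_le_of_eleven ρ hdeg hv).trans_eq (by rw [hv]; norm_num)
    · exact h.sum_cost_le_of_twelve_le ρ hdeg hv
  · have hmono : ((G.neighborFinset v).filter fun w => D w ≤ 5).card ≤
        ((G.neighborFinset v).filter fun w => D w ≤ 8).card :=
      Finset.card_le_card (Finset.monotone_filter_right _ fun w _ hw => hw.trans (by norm_num))
    have hcard' : (((G.neighborFinset v).filter fun w => D w ≤ 5).card : ℚ) + 8 ≤
        G.degree v := by exact_mod_cast (Nat.add_le_add_right hmono 8).trans hcard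
    linarith [ρ.sum_cost_le_card (D := D) v]

theorem charge_nonneg (v : V) : 0 ≤ (G.degree v : ℚ) - 6 +
    ∑ d ∈ dartsAt G v, (ρ.transfer D d.symm - ρ.cost D d) := by
  have htransfer : 0 ≤ ∑ d ∈ dartsAt G v, ρ.transfer D d.symm :=
    Finset.sum_nonneg fun d _ => ρ.transfer_nonneg
  rcases le_or_gt 7 (D v) with h7 | h7
  · rw [Finset.sum_sub_distrib]
    linarith [h.sum_cost_le ρ h7]
  have hcost : ∀ d ∈ dartsAt G v, ρ.transfer D d.symm - ρ.cost D d =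
      ρ.sides d / 4 + ρ.transfer D d.symm := fun d hd => by
    rw [RotationSystem.cost, h.transfer_of_le_six ρ (d := d) (by rw [mem_dartsAt.1 hd]; omega)]
    ring
  have hsides : 0 ≤ ∑ d ∈ dartsAt G v, ρ.sides d / 4 :=
    Finset.sum_nonneg fun d _ => div_nonneg (ρ.sides_nonneg d) zero_le_four
  rw [h.degree_eq_of_le (by omega), Finset.sum_congr rfl hcost]
  have h3 := h.three_le_apply v
  rcases (by omega : D v = 3 ∨ D v = 4 ∨ D v = 5 ∨ D v = 6) with hv | hv | hv | hv <;> rw [hv]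
  · have hone : ∀ d ∈ dartsAt G v, ρ.sides d / 4 + ρ.transfer D d.symm = 1 := fun d hd => by
      rw [ρ.transfer_of_three (d := d.symm) (by rw [← hv, ← mem_dartsAt.1 hd]; rfl), ρ.sides_symm]
      ring
    rw [Finset.sum_congr rfl hone, Finset.sum_const, card_dartsAt, h.degree_eq_of_le (by omega),
      hv]
    norm_num
  · rw [Finset.sum_add_distrib]
    push_cast
    linarith [h.two_le_sum_transfer_symm ρ hv]
  · push_cast
    linarith [h.one_le_sum_of_five ρ hv]
  · rw [Finset.sum_add_distrib]
    push_cast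
    linarith

theorem not_isPlanar [Nonempty V] : ¬ G.IsPlanar := fun hG => by
  obtain ⟨ρ, heuler⟩ := exists_rotationSystem_euler hG
  have htotal := ρ.sum_degree_sub_six_add_sum_gap_le
    (fun v => (by norm_num : 2 ≤ 3).trans (h.three_le v)) heuler
  have hcharge := Finset.sum_nonneg fun v (_ : v ∈ Finset.univ) => h.charge_nonneg ρ v
  have hsymm : ∑ d : G.Dart, ρ.transfer D d.symm = ∑ d, ρ.transfer D d :=
    Equiv.sum_comp (dartReverse G) (ρ.transfer D)
  have htransfer : ∑ d, (ρ.transfer D d.symm - ρ.cost D d) = (∑ d, ρ.gap d) / 2 := by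
    simp only [RotationSystem.cost]
    rw [Finset.sum_sub_distrib, Finset.sum_sub_distrib, hsymm, ← Finset.sum_div, ρ.sum_sides]
    ring
  rw [Finset.sum_add_distrib, sum_sum_dartsAt, htransfer] at hcharge
  linarith

end ConfigFree

theorem isPlanar_induce {V : Type*} {G : SimpleGraph V} (h : G.IsPlanar) (s : Set V) :
    (G.induce s).IsPlanar := by
  obtain ⟨P⟩ := h
  have hmap : ∀ e : Sym2 s, e ∈ (G.induce s).edgeSet → e.map Subtype.val ∈ G.edgeSet :=
    fun e => Sym2.ind (fun _ _ he => he) e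
  have hinj : Function.Injective (Sym2.map (Subtype.val : s → V)) :=
    Sym2.map.injective Subtype.val_injective
  exact ⟨{
    pos := fun v => P.pos v
    arc := fun e => P.arc (e.map Subtype.val)
    pos_injective := P.pos_injective.comp Subtype.val_injective
    isArc := fun u v huv => P.isArc u v huv
    vertex_on_arc := fun e he w hw => by
      obtain ⟨w', hw', hww'⟩ := Sym2.mem_map.1 (P.vertex_on_arc _ (hmap e he) w hw)
      rwa [← Subtype.ext hww']
    arc_inter_arc := fun e he f hf hef x hx => by
      obtain ⟨w, hwe, hwf, rfl⟩ := P.arc_inter_arc _ (hmap e he) _ (hmap f hf)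
        (hinj.ne hef) x hx
      obtain ⟨a, ha, rfl⟩ := Sym2.mem_map.1 hwe
      obtain ⟨b, hb, hab⟩ := Sym2.mem_map.1 hwf
      exact ⟨a, ha, Subtype.ext hab ▸ hb, rfl⟩ }⟩

theorem val_le_val_of_strictMono {m k : ℕ} {φ : Fin m → Fin k} (hφ : StrictMono φ) (i : Fin m) :
    (i : ℕ) ≤ φ i := by
  have hcard := Finset.card_le_card_of_injOn (s := Finset.Iio i) (t := Finset.Iio (φ i)) φ
    (fun j hj => Finset.mem_Iio.2 (hφ (Finset.mem_Iio.1 hj))) hφ.injective.injOn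
  rwa [Fin.card_Iio, Fin.card_Iio] at hcard

theorem sum_castLE_le_sum {M : Type*} [AddCommMonoid M] [PartialOrder M] [IsOrderedAddMonoid M]
    {m k : ℕ} {f : Fin k → M} (hf : Monotone f) {s : Finset (Fin k)} (hs : s.card = m)
    (hmk : m ≤ k) : ∑ i : Fin m, f (Fin.castLE hmk i) ≤ ∑ i ∈ s, f i := by
  rw [← Finset.map_orderEmbOfFin_univ s hs, Finset.sum_map]
  refine Finset.sum_le_sum fun i _ => hf ?_
  exact Fin.le_def.2 (val_le_val_of_strictMono (s.orderEmbOfFin hs).strictMono i)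

section Neighbours

variable {V : Type*} [Fintype V] {G : SimpleGraph V} [DecidableRel G.Adj] {u v w : V} {k : ℕ}

theorem two_le_degree_of_isTwoConnected (h : G.IsTwoConnected) (v : V) : 2 ≤ G.degree v := by
  classical
  obtain ⟨hcard, -, hdel⟩ := h
  have hother : ∀ u, u ≠ v → ∃ w, G.Adj v w ∧ w ≠ u := fun u hu => by
    obtain ⟨w, hw⟩ : ∃ w, w ∉ ({u, v} : Finset V) := by
      by_contra! hall
      have := Finset.card_le_two (a := u) (b := v)
      rw [Finset.eq_univ_of_forall hall, Finset.card_univ] at this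
      omega
    simp only [Finset.mem_insert, Finset.mem_singleton, not_or] at hw
    have : Nontrivial {w | w ≠ u} :=
      ⟨⟨⟨v, hu.symm⟩, ⟨w, hw.1⟩, fun hvw => hw.2 (congrArg Subtype.val hvw).symm⟩⟩
    obtain ⟨⟨x, hx⟩, hadj⟩ :=
      (hdel u).preconnected.exists_adj_of_nontrivial (⟨v, hu.symm⟩ : {w | w ≠ u})
    exact ⟨x, hadj, hx⟩
  obtain ⟨u, hu⟩ := Fintype.exists_ne_of_one_lt_card (by omega) v
  obtain ⟨w, hw, -⟩ := hother u hu
  obtain ⟨x, hx, hxw⟩ := hother w hw.ne'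
  rw [← card_neighborFinset_eq_degree]
  exact Finset.one_lt_card.2 ⟨w, by simpa using hw, x, by simpa using hx, hxw.symm⟩

theorem exists_sorted_nbrs {α : Type*} [LinearOrder α] (hv : G.degree v = k) (key : V → α) :
    ∃ x : Fin k → V, Function.Injective x ∧ Set.range x = G.neighborSet v ∧
      Monotone (key ∘ x) := by
  let e : Fin k ≃ G.neighborSet v :=
    (Fintype.equivFinOfCardEq ((G.card_neighborSet_eq_degree v).trans hv)).symm
  let τ := Tuple.sort fun i => key (e i)
  refine ⟨fun i => e (τ i), ?_, ?_, Tuple.monotone_sort fun i => key (e i)⟩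
  · exact Subtype.val_injective.comp (e.injective.comp τ.injective)
  · exact ((τ.trans e).surjective.range_comp Subtype.val).trans Subtype.range_coe

theorem exists_isSortedNbrs (hv : G.degree v = k) : ∃ x : Fin k → V, G.IsSortedNbrs v x :=
  exists_sorted_nbrs hv fun w => G.degree w

theorem exists_isSortedNbrs_zero_last (hv : G.degree v = k + 1) (hu : G.Adj v u)
    (hw : G.Adj v w) (huw : u ≠ w) (hmin : ∀ y, G.Adj v y → G.degree u ≤ G.degree y)
    (hmax : ∀ y, G.Adj v y → G.degree y ≤ G.degree w) :
    ∃ x : Fin (k + 1) → V, G.IsSortedNbrs v x ∧ x 0 = u ∧ x (Fin.last k) = w := by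
  classical
  let key : V → ℕ := fun y =>
    if y = u then 0 else if y = w then G.degree w + 2 else G.degree y + 1
  obtain ⟨x, hinj, hrange, hmono⟩ := exists_sorted_nbrs hv key
  have hadj : ∀ i, G.Adj v (x i) := fun i => hrange.subset (Set.mem_range_self i)
  obtain ⟨i, hi⟩ := hrange.superset hu
  obtain ⟨j, hj⟩ := hrange.superset hw
  refine ⟨x, ⟨hinj, hrange, fun i j hij => ?_⟩, ?_, ?_⟩
  · have hkey : key (x i) ≤ key (x j) := hmono hij
    have hiu := hmin _ (hadj j)
    have hjw := hmax _ (hadj i)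
    have := hmax _ (hadj j)
    rcases eq_or_ne (x i) u with rfl | hi
    · exact hiu
    rcases eq_or_ne (x j) w with rfl | hj
    · exact hjw
    change G.degree (x i) ≤ G.degree (x j)
    simp only [key, if_neg hi, if_neg hj] at hkey
    split_ifs at hkey <;> omega
  · have hkey : key (x 0) ≤ key (x i) := hmono (Fin.zero_le i)
    by_contra hne
    simp only [key, if_neg hne, if_pos hi] at hkey
    split_ifs at hkey <;> omega
  · have hkey : key (x j) ≤ key (x (Fin.last k)) := hmono (Fin.le_last j)
    by_contra hne
    have := hmax _ (hadj (Fin.last k))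
    simp only [key, hj, if_neg huw.symm, if_neg hne, if_pos] at hkey
    split_ifs at hkey <;> omega

theorem neighborFinset_eq_map_univ {x : Fin k → V} (hx : G.IsSortedNbrs v x) :
    G.neighborFinset v = Finset.univ.map ⟨x, hx.1⟩ := by
  ext w
  simpa using (Set.ext_iff.1 hx.2.1 w).symm

theorem sum_degree_castLE_le_sum {x : Fin k → V} (hx : G.IsSortedNbrs v x) {s : Finset V}
    (hsub : s ⊆ G.neighborFinset v) {m : ℕ} (hs : s.card = m) (hmk : m ≤ k) :
    ∑ i : Fin m, G.degree (x (Fin.castLE hmk i)) ≤ ∑ w ∈ s, G.degree w := by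
  rw [neighborFinset_eq_map_univ hx] at hsub
  obtain ⟨t, -, rfl⟩ := Finset.subset_map_iff.1 hsub
  rw [Finset.card_map] at hs
  rw [Finset.sum_map]
  exact sum_castLE_le_sum hx.2.2 hs hmk

end Neighbours

section NoConfig

variable {V : Type*} [Fintype V] {G : SimpleGraph V} [DecidableRel G.Adj] {u v w : V}
  (hA1 : ¬ G.ConfigA1) (hA2 : ¬ G.ConfigA2) (hA3 : ¬ G.ConfigA3) (hA4 : ¬ G.ConfigA4)
  (hdeg : ∀ v, 2 ≤ G.degree v)

include hA1

theorem ten_le_degree (huv : G.Adj u v) (hv : G.degree v = 2) : 10 ≤ G.degree u := by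
  by_contra hlt
  have hcard : 1 < (G.neighborFinset v).card := by
    rw [card_neighborFinset_eq_degree, hv]
    norm_num
  obtain ⟨w, hw, hwu⟩ := Finset.exists_mem_ne hcard u
  exact hA1 ⟨u, v, w, huv, (mem_neighborFinset _ _ _).1 hw, hwu.symm, hv, by omega⟩

include hA3 hdeg

theorem four_le_degree (hv : G.degree v ≤ 8) (hvw : G.Adj v w) : 4 ≤ G.degree w := by
  by_contra hlt
  have := hdeg w
  rcases (by omega : G.degree w = 2 ∨ G.degree w = 3) with hw | hw
  · have := ten_le_degree hA1 hvw hw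
    omega
  · exact hA3 ⟨w, v, hw, hvw.symm, Or.inl hv⟩

include hA4

theorem eighteen_le_degree_add_degree (hv : G.degree v = 4) (hu : G.Adj v u) (hw : G.Adj v w)
    (huw : u ≠ w) (hu7 : G.degree u ≤ 7) : 18 ≤ G.degree u + G.degree w := by
  classical
  by_contra hlt
  obtain ⟨x, hx⟩ := exists_isSortedNbrs hv
  obtain ⟨i, hi⟩ := hx.2.1.superset hu
  have hzero : G.degree (x 0) ≤ G.degree (x i) := hx.2.2 (Fin.zero_le i)
  have hfour := four_le_degree hA1 hA3 hdeg (by omega) (hx.2.1.subset (Set.mem_range_self 0))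
  have hsum := sum_degree_castLE_le_sum hx (s := {u, w})
    (by simp [Finset.insert_subset_iff, hu, hw]) (Finset.card_pair huw) (by norm_num)
  rw [Fin.sum_univ_two, Finset.sum_pair huw] at hsum
  change G.degree (x 0) + G.degree (x 1) ≤ _ at hsum
  exact hA4 (Or.inl ⟨v, x, hv, hx, hfour, by rw [hi] at hzero; omega, by omega⟩)

theorem nineteen_le_degree_add_degree_add_degree {a b c : V} (hv : G.degree v = 5)
    (ha : G.Adj v a) (hb : G.Adj v b) (hc : G.Adj v c) (hab : a ≠ b) (hac : a ≠ c)
    (hbc : b ≠ c) : 19 ≤ G.degree a + G.degree b + G.degree c := by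
  classical
  by_contra hlt
  obtain ⟨x, hx⟩ := exists_isSortedNbrs hv
  have h01 : G.degree (x 0) ≤ G.degree (x 1) := hx.2.2 (Fin.zero_le 1)
  have h02 : G.degree (x 0) ≤ G.degree (x 2) := hx.2.2 (Fin.zero_le 2)
  have hfour := four_le_degree hA1 hA3 hdeg (by omega) (hx.2.1.subset (Set.mem_range_self 0))
  have hsum := sum_degree_castLE_le_sum hx (s := {a, b, c})
    (by simp [Finset.insert_subset_iff, ha, hb, hc])
    (Finset.card_eq_three.2 ⟨a, b, c, hab, hac, hbc, rfl⟩) (by norm_num)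
  rw [Fin.sum_univ_three, Finset.sum_insert (by simp [hab, hac]), Finset.sum_pair hbc] at hsum
  change G.degree (x 0) + G.degree (x 1) + G.degree (x 2) ≤ _ at hsum
  exact hA4 (Or.inr ⟨v, x, hv, hx, Or.inl ⟨hfour, by omega, by omega⟩⟩)

omit hA1 hA3 hdeg in
theorem not_adj_of_six_of_seven (hv : G.degree v = 5)
    (h67 : ∀ y, G.Adj v y → G.degree y = 6 ∨ G.degree y = 7)
    (hcard : ((G.neighborFinset v).filter fun y => G.degree y = 6).card = 2)
    (hu : G.Adj v u) (hw : G.Adj v w) (hu6 : G.degree u = 6) (hw7 : G.degree w = 7) :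
    ¬ G.Adj u w := fun huw => by
  obtain ⟨x, hx, hx0, hx4⟩ := exists_isSortedNbrs_zero_last hv hu hw huw.ne
    (fun y hy => by have := h67 y hy; omega) fun y hy => by have := h67 y hy; omega
  change x 4 = w at hx4
  have hdegree : ∀ i, G.degree (x i) = 6 ∨ G.degree (x i) = 7 := fun i =>
    h67 _ (hx.2.1.subset (Set.mem_range_self i))
  rw [← hx0] at hu6 huw
  rw [← hx4] at hw7 huw
  rw [neighborFinset_eq_map_univ hx, Finset.card_filter, Finset.sum_map,
    Fin.sum_univ_five] at hcard
  change (if G.degree (x 0) = 6 then 1 else 0) + (if G.degree (x 1) = 6 then 1 else 0) +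
    (if G.degree (x 2) = 6 then 1 else 0) + (if G.degree (x 3) = 6 then 1 else 0) +
    (if G.degree (x 4) = 6 then 1 else 0) = 2 at hcard
  have h12 : G.degree (x 1) ≤ G.degree (x 2) := hx.2.2 (by decide)
  have h23 : G.degree (x 2) ≤ G.degree (x 3) := hx.2.2 (by decide)
  have hmiddle : G.degree (x 1) = 6 ∧ G.degree (x 2) = 7 ∧ G.degree (x 3) = 7 := by
    have := hdegree 1
    have := hdegree 2
    have := hdegree 3
    split_ifs at hcard <;> omega
  exact hA4 (Or.inr ⟨v, x, hv, hx,
    Or.inr ⟨hu6, hmiddle.1, hmiddle.2.1, hmiddle.2.2, hw7, huw⟩⟩)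

end NoConfig

section Core

variable {V : Type*} [Fintype V] {G : SimpleGraph V} [DecidableRel G.Adj]

variable (G) in
/-- The vertices of degree at least 3. Discharging takes place on the subgraph that they induce,
with the degrees of `G` remembered. -/
abbrev core : Set V := {v | 3 ≤ G.degree v}

theorem card_filter_core (v : core G) (p : V → Prop) [DecidablePred p] :
    (((G.induce (core G)).neighborFinset v).filter fun w => p w.1).card =
      ((G.neighborFinset v).filter fun w => p w ∧ 3 ≤ G.degree w).card := by
  refine Finset.card_bij (fun w _ => (w : V)) (fun w hw => ?_) (fun _ _ _ _ hw => Subtype.ext hw)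
    fun w hw => ?_
  · rw [Finset.mem_filter, mem_neighborFinset] at hw ⊢
    exact ⟨hw.1, hw.2, w.2⟩
  · rw [Finset.mem_filter, mem_neighborFinset] at hw
    exact ⟨⟨w, hw.2.2⟩, Finset.mem_filter.2 ⟨(mem_neighborFinset _ _ _).2 hw.1, hw.2.1⟩, rfl⟩

theorem card_filter_core_add (hdeg : ∀ v, 2 ≤ G.degree v) (v : core G) (p : V → Prop)
    [DecidablePred p] : (((G.induce (core G)).neighborFinset v).filter fun w => p w.1).card +
      ((G.neighborFinset v).filter fun w => p w ∧ G.degree w = 2).card =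
        ((G.neighborFinset v).filter fun w => p w).card := by
  have htwo : ∀ w, G.degree w = 2 ↔ ¬ 3 ≤ G.degree w := fun w => by
    have := hdeg w
    omega
  simp only [card_filter_core, htwo, ← Finset.filter_filter]
  exact Finset.card_filter_add_card_filter_not _

theorem degree_core_add_numNbrs (hdeg : ∀ v, 2 ≤ G.degree v) (v : core G) :
    (G.induce (core G)).degree v + G.numNbrs 2 v = G.degree v := by
  simpa [numNbrs] using card_filter_core_add hdeg v fun _ => True

theorem card_core_add_numNbrs (hdeg : ∀ v, 2 ≤ G.degree v) {k : ℕ} (hk : 2 ≤ k) (v : core G) :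
    (((G.induce (core G)).neighborFinset v).filter fun w => G.degree w.1 ≤ k).card +
      G.numNbrs 2 v = G.numNbrsLE k v := by
  rw [numNbrs, numNbrsLE, ← card_filter_core_add hdeg v fun w => G.degree w ≤ k]
  congr 2
  exact Finset.filter_congr fun w _ => ⟨fun hw => ⟨hw.trans_le hk, hw⟩, And.right⟩

theorem degree_core_eq_or (hA1 : ¬ G.ConfigA1) (hA2 : ¬ G.ConfigA2) (hdeg : ∀ v, 2 ≤ G.degree v)
    (v : core G) : (G.induce (core G)).degree v = G.degree v ∨ 9 ≤ G.degree v ∧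
      (((G.induce (core G)).neighborFinset v).filter fun w => G.degree w.1 ≤ 8).card + 8 ≤
        (G.induce (core G)).degree v := by
  have hcore := degree_core_add_numNbrs hdeg v
  have hsmall := card_core_add_numNbrs hdeg (k := 8) (by norm_num) v
  refine (Nat.eq_zero_or_pos (G.numNbrs 2 v)).imp (fun hzero => by omega) fun hpos => ?_
  obtain ⟨w, hw⟩ := Finset.card_pos.1 hpos
  rw [Finset.mem_filter, mem_neighborFinset] at hw
  have hten := ten_le_degree hA1 hw.1 hw.2
  have hcount := not_and.1 (not_exists.1 hA2 v) hpos
  omega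

theorem configFree_core (hA1 : ¬ G.ConfigA1) (hA2 : ¬ G.ConfigA2) (hA3 : ¬ G.ConfigA3)
    (hA4 : ¬ G.ConfigA4) (hdeg : ∀ v, 2 ≤ G.degree v) :
    ConfigFree (G.induce (core G)) fun v => G.degree v where
  three_le v := by
    have : 3 ≤ G.degree v := v.2
    have := degree_core_eq_or hA1 hA2 hdeg v
    omega
  degree_eq := degree_core_eq_or hA1 hA2 hdeg
  three_adj u v hu huv := by
    by_contra hlt
    exact hA3 ⟨u, v, hu, huv, Or.inl (by omega)⟩
  three_nine u v w hu hv huv huw hvw := hA3 ⟨u, v, hu, huv, Or.inr (Or.inl ⟨hv, w, huw, hvw⟩)⟩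
  three_ten u v w x hu hv huv hwx huw hvw hux hvx := by
    by_contra hlt
    have hfive := card_core_add_numNbrs hdeg (k := 5) (by norm_num) v
    exact hA3 ⟨u, v, hu, huv, Or.inr (Or.inr ⟨hv, by omega, w, x, Subtype.coe_injective.ne hwx,
      ⟨huw, hvw⟩, hux, hvx⟩)⟩
  four v u w hv hu hw huw :=
    eighteen_le_degree_add_degree hA1 hA3 hA4 hdeg hv hu hw (Subtype.coe_injective.ne huw)
  five v x y z hv hx hy hz hxy hxz hyz :=
    nineteen_le_degree_add_degree_add_degree hA1 hA3 hA4 hdeg hv hx hy hz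
      (Subtype.coe_injective.ne hxy) (Subtype.coe_injective.ne hxz) (Subtype.coe_injective.ne hyz)
  five_six_seven v hv h67 hcard x y hx hy := by
    have hmem : ∀ w, G.Adj v w → w ∈ core G := fun w hw =>
      (by norm_num : 3 ≤ 4).trans (four_le_degree hA1 hA3 hdeg (by omega) hw)
    refine not_adj_of_six_of_seven hA4 hv (fun w hw => h67 ⟨w, hmem w hw⟩ hw) ?_ hx hy
    rw [← hcard, card_filter_core v fun w => G.degree w = 6]
    refine congrArg Finset.card (Finset.filter_congr fun w hw => ?_)
    exact (and_iff_left (hmem w ((mem_neighborFinset _ _ _).1 hw))).symm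

theorem nonempty_core [Nonempty V] (hA1 : ¬ G.ConfigA1) (hdeg : ∀ v, 2 ≤ G.degree v) :
    Nonempty (core G) := by
  obtain ⟨v⟩ := ‹Nonempty V›
  rcases (hdeg v).eq_or_lt with hv | hv
  · obtain ⟨w, hw⟩ := (G.degree_pos_iff_exists_adj v).1 (hv ▸ two_pos)
    exact ⟨w, (by norm_num : 3 ≤ 10).trans (ten_le_degree hA1 hw.symm hv.symm)⟩
  · exact ⟨v, hv⟩

end Core

theorem lemma1_general {V : Type*} [Fintype V] [Nonempty V] (G : SimpleGraph V)
    [DecidableRel G.Adj] (hplanar : G.IsPlanar) (hdeg : ∀ v, 2 ≤ G.degree v) :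
    G.ConfigA1 ∨ G.ConfigA2 ∨ G.ConfigA3 ∨ G.ConfigA4 := by
  by_contra! hfree
  obtain ⟨hA1, hA2, hA3, hA4⟩ := hfree
  have := nonempty_core hA1 hdeg
  exact (configFree_core hA1 hA2 hA3 hA4 hdeg).not_isPlanar (isPlanar_induce hplanar _)

theorem lemma1 {V : Type*} [Fintype V] (G : SimpleGraph V) [DecidableRel G.Adj]
    (hconn : G.IsTwoConnected) (hplanar : G.IsPlanar) (hdeg : 5 ≤ G.maxDegree) :
    G.ConfigA1 ∨ G.ConfigA2 ∨ G.ConfigA3 ∨ G.ConfigA4 :=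
  have := hconn.2.1.nonempty
  lemma1_general G hplanar (two_le_degree_of_isTwoConnected hconn)
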